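/- \textbf{FA-presentations.} For words $w_1,\dots,w_n$ over a finite alphabet $A$, let $\mathrm{conv}(w_1,\dots,w_n)$ be the word over $(A\cup\{\$\})^n$ of length $\max_i|w_i|$ whose $j$-th letter is the tuple of the $j$-th letters of the $w_i$, where $\$\notin A$ replaces missing letters. A relation $R\subseteq(A^*)^n$ is regular if $\mathrm{conv}(R)$ is a regular language. An FA-presentation of an algebra $\mathcal S$ with carrier set $S$ is a pair $(K,\phi)$, where $K$ is a regular language over a finite alphabet and $\phi:K\to S$ is surjective, such that the relation $\{(v,w)\in K^2: v\phi=w\phi\}$ and, for each operation $f$ of $\mathcal S$ (of arity $n$), the relation $\{(w_1,\dots,w_n,w)\in K^{n+1}: f(w_1\phi,\dots,w_n\phi)=w\phi\}$ are regular. $\mathcal S$ is FA-presentable if it has an FA-presentation. \textbf{The machine.} Let $T$ be a deterministic one-tape Turing machine (with a two-way infinite tape) that never halts, with finite state set $Q$, finite tape alphabet $B$ containing the blank, a distinguished non-blank letter $a\in B$ and a distinguished state $q_\square\in Q$. Its configurations are the words $uqv\in B^*QB^*$: the state is $q$, the tape contents are $uv$, and the head is on the first symbol of $v$ (on the blank just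 after $u$ if $v$ is empty). Say that $T$ \emph{generates squares} if, started on the empty tape, it reaches state $q_\square$ with tape contents $a^{1^2}$, later with tape contents $a^{2^2}$, later with $a^{3^2}$, and so on, and if throughout this computation it is in state $q_\square$ exactly when its tape contents are $a^{j^2}$ for some $j\ge1$. \textbf{The algebras.} Let $S$ be the zero-union, with zero $0_S$, of chains $M_i$ ($i\ge0$), where $M_i$ has $2^i$ elements; $S$ is a semilattice under meet. Let $G_\top,G_\bot$ be two disjoint copies of the set of configurations of $T$, and let $X=S\cup G_\top\cup G_\bot$. Fix a strict total order on $B\cup Q$ (taken as a disjoint union). Define operations on $X$; each unary operation is the identity where nothing is said. \begin{itemize} \item $\circ$ is the meet on $S$, and $g\circ g'=g$, $g\circ s=s\circ g=g$ for $g,g'\in G_\top\cup G_\bot$, $s\in S$. \item $\alpha$ sends each configuration in $G_\top$ to its copy in $G_\bot$. \item $\beta$ sends each element of a chain $M_i$ to the element immediately below it in $M_i$, and the minimum of $M_i$ to $0_S$. \item $\gamma$ sends a configuration in $G_\bot$ with state $q_\square$ and tape contents $a^k$ to the maximum of $M_k$. \item $\delta$ performs one computation step of $T$ on $G_\bot$.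 \item $\zeta$ sends each configuration in $G_\top$ to its immediate successor in the length-plus-lexicographic order of the words in $B^*QB^*$. \item $\lambda$ sends each element of a chain $M_i$ to the maximum of $M_i$. \item $\mu$ sends each element of $S$ to $0_S$. \end{itemize} Let $\mathcal X=(X,\circ,\alpha,\beta,\gamma,\delta,\zeta)$ and $\mathcal X'=(X,\alpha,\beta,\gamma,\delta,\zeta,\lambda,\mu)$. Let $g_0\in G_\bot$ be the initial configuration, let $\mathcal Y$ and $\mathcal Y'$ be the subalgebras generated by $g_0$ of $\mathcal X$ and of $\mathcal X'$, respectively, and let $H\subseteq G_\bot$ be the set of configurations reachable from $g_0$. \textbf{Claim.} A machine $T$ that generates squares exists. For every machine $T$ that generates squares and every strict total order on $B\cup Q$: \begin{enumerate} \item $\mathcal X'$ has only unary operations, is FA-presentable and is finitely generated; \item $\mathcal Y$ and $\mathcal Y'$ have the same domain, namely $Y=\{0_S\}\cup H\cup\bigcup_{j\ge1}M_{j^2}$; \item $\mathcal Y'$ is not FA-presentable. \end{enumerate} Hence finitely generated subalgebras of finitely generated FA-presentable algebras need not be FA-presentable, even when the algebras have only finitely many operations, all of them unary. -/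

import Mathlib

namespace FAPres

open FirstOrder

/-! ### Convolution and FA-presentations -/

/-- `conv (w₁, …, wₙ)`: the word of `n`-tuples whose `j`-th letter is the tuple of `j`-th letters of
the words `wᵢ`; the padding symbol `$` is `none`. Its length is the maximum of the lengths. -/
def conv {A : Type*} {n : ℕ} (w : Fin n → List A) : List (Fin n → Option A) :=
  List.ofFn (n := Finset.univ.sup fun i => (w i).length) fun j i => (w i)[(j : ℕ)]?

/-- A relation on words is regular if its convolution is a regular language over `(A ∪ {$})ⁿ`. -/
def IsRegularRel {A : Type*} {n : ℕ} (R : Set (Fin n → List A)) : Prop :=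
  Language.IsRegular (conv '' R : Language (Fin n → Option A))

/-- `Λ(R, φ)`: the tuples of words in `K` that represent tuples in `R`. -/
def Lam {A S : Type*} {K : Language A} (φ : {w : List A // w ∈ K} → S) {n : ℕ}
    (R : (Fin n → S) → Prop) : Set (Fin n → List A) :=
  {w | ∃ h : ∀ i, w i ∈ K, R fun i => φ ⟨w i, h i⟩}

/-- `(K, φ)` is an FA-presentation of the structure `M`: here `K` is a regular language, `φ` maps
`K` onto `M`, and equality, all relations and (the graphs of) all operations of `M` pull back to
regular relations on words. -/
structure IsFAPresentation (L : FirstOrder.Language) (M : Type*) [L.Structure M] {A : Type*}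
    (K : Language A) (φ : {w : List A // w ∈ K} → M) : Prop where
  regular : K.IsRegular
  surjective : Function.Surjective φ
  eq_regular : IsRegularRel (Lam φ fun x : Fin 2 → M => x 0 = x 1)
  rel_regular : ∀ (n : ℕ) (R : L.Relations n),
    IsRegularRel (Lam φ fun x : Fin n → M => Language.Structure.RelMap R x)
  fun_regular : ∀ (n : ℕ) (f : L.Functions n),
    IsRegularRel (Lam φ fun x : Fin (n + 1) → M =>
      Language.Structure.funMap f (Fin.init x) = x (Fin.last n))

/-- `M` admits an FA-presentation over some finite alphabet. -/
def FAPresentable (L : FirstOrder.Language) (M : Type*) [L.Structure M] : Prop :=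
  ∃ (A : Type) (_ : Finite A) (K : Language A) (φ : {w : List A // w ∈ K} → M),
    IsFAPresentation L M K φ

/-- The signature consists of unary operation symbols only. -/
def OnlyUnaryOperations (L : FirstOrder.Language) : Prop :=
  L.IsAlgebraic ∧ ∀ n, n ≠ 1 → IsEmpty (L.Functions n)

/-! ### Turing machines and their configuration graphs -/

inductive Move
  | left
  | right
  | stay

/-- A deterministic non-halting Turing machine with tape alphabet `B` (containing the blank) and
state set `Q`, with one tape that is infinite in both directions. The letter `a` and the state `sq`
are distinguished. -/
structure Machine (B Q : Type) where
  blank : B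
  a : B
  a_ne_blank : a ≠ blank
  start : Q
  sq : Q
  tr : Q → B → Q × B × Move

/-- The configuration written as the word `u q v` of `B* Q B*`: the state is `q`, the tape contains
`uv`, and the head points to the first symbol of `v` (to a blank just after `u` if `v` is empty). -/
structure Config (B Q : Type) where
  u : List B
  q : Q
  v : List B

namespace Config

variable {B Q : Type}

def contents (c : Config B Q) : List B := c.u ++ c.v

/-- The word `u q v`. -/
def word (c : Config B Q) : List (B ⊕ Q) :=
  c.u.map Sum.inl ++ Sum.inr c.q :: c.v.map Sum.inl

end Config

namespace Machine

variable {B Q : Type} (T : Machine B Q)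

/-- The initial configuration: start state and empty tape. -/
def init : Config B Q := ⟨[], T.start, []⟩

/-- One computation step. -/
def next (c : Config B Q) : Config B Q :=
  match T.tr c.q (c.v.headD T.blank) with
  | (q', b, .right) => ⟨c.u ++ [b], q', c.v.tail⟩
  | (q', b, .stay) => ⟨c.u, q', b :: c.v.tail⟩
  | (q', b, .left) => ⟨c.u.dropLast, q', c.u.getLastD T.blank :: b :: c.v.tail⟩

/-- The configuration after `n` steps from the initial configuration. -/
def run (n : ℕ) : Config B Q := T.next^[n] T.init

/-- Started on the empty tape, `T` reaches the state `sq` with tape contents `a^(1²)`, later with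
tape contents `a^(2²)`, later with `a^(3²)`, and so on; and during the whole computation it is in
the state `sq` exactly when its tape contents are `a^(j²)` for some `j ≥ 1`. -/
def GeneratesSquares : Prop :=
  (∃ t : ℕ → ℕ, StrictMono t ∧ ∀ j : ℕ,
    (T.run (t j)).q = T.sq ∧ (T.run (t j)).contents = List.replicate ((j + 1) ^ 2) T.a) ∧
  ∀ n : ℕ, (T.run n).q = T.sq ↔
    ∃ j : ℕ, 1 ≤ j ∧ (T.run n).contents = List.replicate (j ^ 2) T.a

end Machine

/-! ### The carrier set -/

/-- `X = S ∪ G_⊤ ∪ G_⊥`, where `S` consists of a zero and of chains `Mᵢ` with `2ⁱ` elements, and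
`G_⊤`, `G_⊥` are two copies of the set of configurations. -/
inductive Carrier (B Q : Type)
  | zero : Carrier B Q
  | chain (i : ℕ) (x : Fin (2 ^ i)) : Carrier B Q
  | top (c : Config B Q) : Carrier B Q
  | bot (c : Config B Q) : Carrier B Q

/-- The maximum element of the chain `Mᵢ`. -/
def chainMax {B Q : Type} (i : ℕ) : Carrier B Q :=
  .chain i ⟨2 ^ i - 1, Nat.sub_lt (Nat.two_pow_pos i) Nat.one_pos⟩

/-- The length-plus-lexicographic order on configurations in `G_⊤`, induced by the order `r` on
letters. The words are compared without their common first letter `⊤`, which makes no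
difference. -/
def configLT {B Q : Type} (r : B ⊕ Q → B ⊕ Q → Prop) (c d : Config B Q) : Prop :=
  List.Shortlex r c.word d.word

theorem configLT_wf {B Q : Type} [Finite B] [Finite Q] (r : B ⊕ Q → B ⊕ Q → Prop)
    [IsStrictTotalOrder (B ⊕ Q) r] : WellFounded (configLT r) :=
  InvImage.wf Config.word (List.Shortlex.wf (Finite.wellFounded_of_trans_of_irrefl r))

theorem exists_configLT {B Q : Type} (r : B ⊕ Q → B ⊕ Q → Prop) (b : B) (c : Config B Q) :
    {d | configLT r c d}.Nonempty :=
  ⟨⟨b :: c.u, c.q, c.v⟩, List.Shortlex.of_length_lt (by simp [Config.word])⟩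

namespace Machine

variable {B Q : Type} (T : Machine B Q)

/-- The immediate successor in the length-plus-lexicographic order. -/
noncomputable def succ [Finite B] [Finite Q] (r : B ⊕ Q → B ⊕ Q → Prop)
    [IsStrictTotalOrder (B ⊕ Q) r] (c : Config B Q) : Config B Q :=
  (configLT_wf r).min {d | configLT r c d} (exists_configLT r T.blank c)

end Machine

/-! ### The operations -/

section Operations

variable {B Q : Type}

/-- The meet on the semilattice `S`, extended by `g ∘ g' = g` and `g ∘ s = s ∘ g = g`. -/
def circ : Carrier B Q → Carrier B Q → Carrier B Q
  | .top c, _ => .top c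
  | .bot c, _ => .bot c
  | _, .top c => .top c
  | _, .bot c => .bot c
  | .chain i x, .chain j y =>
      if i = j then (if (x : ℕ) ≤ (y : ℕ) then .chain i x else .chain j y) else .zero
  | _, _ => .zero

def alpha : Carrier B Q → Carrier B Q
  | .top c => .bot c
  | x => x

/-- Down by one in each chain, from the minimum of each chain to the zero of `S`. -/
def beta : Carrier B Q → Carrier B Q
  | .chain i x =>
      if (x : ℕ) = 0 then .zero
      else .chain i ⟨(x : ℕ) - 1, lt_of_le_of_lt (Nat.sub_le _ _) x.isLt⟩
  | x => x

open Classical in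
/-- A configuration of `G_⊥` with state `sq` and tape contents `a^k` goes to the maximum of `M_k`. -/
noncomputable def gamma (T : Machine B Q) : Carrier B Q → Carrier B Q
  | .bot c =>
      if c.q = T.sq ∧ c.contents = List.replicate c.contents.length T.a then
        chainMax c.contents.length
      else .bot c
  | x => x

def delta (T : Machine B Q) : Carrier B Q → Carrier B Q
  | .bot c => .bot (T.next c)
  | x => x

noncomputable def zeta (T : Machine B Q) [Finite B] [Finite Q] (r : B ⊕ Q → B ⊕ Q → Prop)
    [IsStrictTotalOrder (B ⊕ Q) r] : Carrier B Q → Carrier B Q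
  | .top c => .top (T.succ r c)
  | x => x

/-- Every element of a chain goes to the maximum of that chain. -/
def lambda : Carrier B Q → Carrier B Q
  | .chain i _ => chainMax i
  | x => x

/-- Every element of `S` goes to the zero of `S`. -/
def mu : Carrier B Q → Carrier B Q
  | .chain _ _ => .zero
  | x => x

end Operations

/-! ### The algebra with the binary operation and the algebra with unary operations only -/

/-- The operation symbols `∘, α, β, γ, δ, ζ`. -/
inductive BinFn : ℕ → Type
  | circ : BinFn 2
  | alpha : BinFn 1
  | beta : BinFn 1
  | gamma : BinFn 1
  | delta : BinFn 1
  | zeta : BinFn 1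

/-- The operation symbols `α, β, γ, δ, ζ, λ, μ`. -/
inductive UnFn : ℕ → Type
  | alpha : UnFn 1
  | beta : UnFn 1
  | gamma : UnFn 1
  | delta : UnFn 1
  | zeta : UnFn 1
  | lambda : UnFn 1
  | mu : UnFn 1

def binLang : FirstOrder.Language := ⟨BinFn, fun _ => Empty⟩

def unLang : FirstOrder.Language := ⟨UnFn, fun _ => Empty⟩

section Algebras

variable {B Q : Type} (T : Machine B Q) (r : B ⊕ Q → B ⊕ Q → Prop)

/-- The algebra `𝒳 = (X, ∘, α, β, γ, δ, ζ)`. -/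
@[nolint unusedArguments]
def AlgX (_T : Machine B Q) (_r : B ⊕ Q → B ⊕ Q → Prop) : Type := Carrier B Q

/-- The algebra `𝒳' = (X, α, β, γ, δ, ζ, λ, μ)`. -/
@[nolint unusedArguments]
def AlgX' (_T : Machine B Q) (_r : B ⊕ Q → B ⊕ Q → Prop) : Type := Carrier B Q

variable [Finite B] [Finite Q] [IsStrictTotalOrder (B ⊕ Q) r]

noncomputable instance : binLang.Structure (AlgX T r) where
  funMap {_} f x := match f, x with
    | .circ, x => FAPres.circ (x 0) (x 1)
    | .alpha, x => FAPres.alpha (x 0)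
    | .beta, x => FAPres.beta (x 0)
    | .gamma, x => FAPres.gamma T (x 0)
    | .delta, x => FAPres.delta T (x 0)
    | .zeta, x => FAPres.zeta T r (x 0)
  RelMap R _ := nomatch R

noncomputable instance : unLang.Structure (AlgX' T r) where
  funMap {_} f x := match f, x with
    | .alpha, x => FAPres.alpha (x 0)
    | .beta, x => FAPres.beta (x 0)
    | .gamma, x => FAPres.gamma T (x 0)
    | .delta, x => FAPres.delta T (x 0)
    | .zeta, x => FAPres.zeta T r (x 0)
    | .lambda, x => FAPres.lambda (x 0)
    | .mu, x => FAPres.mu (x 0)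
  RelMap R _ := nomatch R

/-- The initial configuration of `T` in `G_⊥`. -/
def g₀ : Carrier B Q := .bot T.init

/-- The subalgebra `𝒴` of `𝒳` generated by `g₀`. -/
noncomputable def subY : binLang.Substructure (AlgX T r) :=
  Language.Substructure.closure binLang {(g₀ T : AlgX T r)}

/-- The subalgebra `𝒴'` of `𝒳'` generated by `g₀`. -/
noncomputable def subY' : unLang.Substructure (AlgX' T r) :=
  Language.Substructure.closure unLang {(g₀ T : AlgX' T r)}

end Algebras

/-- `Y = {0_S} ∪ H ∪ ⋃_{j ≥ 1} M_{j²}`, where `H ⊆ G_⊥` is the set of configurations reachable from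
the initial one. -/
def setY {B Q : Type} (T : Machine B Q) : Set (Carrier B Q) :=
  {Carrier.zero} ∪ {y | ∃ n : ℕ, y = .bot (T.run n)} ∪
    {y | ∃ j : ℕ, 1 ≤ j ∧ ∃ x : Fin (2 ^ (j ^ 2)), y = .chain (j ^ 2) x}

end FAPres

/-! Regularity of a binary relation is handled as finiteness of residuals, in the spirit of Myhill
and Nerode: `IsSynchronous` asks for a finite family of relations closed under stripping one pair of
padded letters. Boolean combinations, composition and prefixing preserve this property by
manipulating families, with no automata in sight. `IsSynchronous.isRegularRel` and
`isSynchronous_of_isRegularRel` translate to and from regular languages.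

For the presentation of the large algebra, an element of `M_i` is a bit string of length `i` and a
configuration is its own word, each behind a tag. One step of `T` changes a bounded window, the
order successor is definable from shortlex, `β` is binary decrement, and `γ` compares the length of
a word of letters `a` with that of a string of ones. The algebra is generated by the least
configuration of the top copy: `ζ` exhausts this copy because shortlex has order type `ω`, `α`
copies it, `γ` gives the maximum of every chain, and `β` descends.

Starting from `g₀` instead, `γ` is applied only along the run of `T`, so only chains of square index
appear. Suppose the result had a presentation. The maxima of these chains are definable by `λ x = x`
and `μ x ≠ x`, so their least representatives form an infinite regular language, and pumping yields
infinitely many of them whose lengths grow linearly in `i`. The fibre of `λ` over a maximum is its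
chain. A finite fibre of a regular function has representatives that exceed the word of the image
only by one of finitely many tails (`IsSynchronous.exists_finite_tails`), hence at most
exponentially many in `i` (`exists_fibre_growth`). But the fibres have `2 ^ (j ^ 2)` elements for
distinct `j`, which is too much.

The machine rests on `(m + 1)² + 2(m + 1) + 1 = (m + 2)²`: the head position stores the root, and
the letters up to it are counted off by marks. -/

namespace FAPres

/-! ### Synchronous relations on words -/

section Synchronous

variable {α β γ : Type*}

/-- Binary relations between words. -/
abbrev WordRel (α β : Type*) := List α → List β → Prop

/-- The residual of a relation by a pair of padded letters. -/
def residual (x : Option α) (y : Option β) (R : WordRel α β) : WordRel α β :=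
  fun v w => (x = none → v = []) ∧ (y = none → w = []) ∧ R (x.toList ++ v) (y.toList ++ w)

/-- A relation is synchronous if it belongs to a finite family closed under residuals. -/
def IsSynchronous (R : WordRel α β) : Prop :=
  ∃ F : Set (WordRel α β), F.Finite ∧ R ∈ F ∧ ∀ S ∈ F, ∀ x y, residual x y S ∈ F

theorem residual_bot (x : Option α) (y : Option β) :
    residual x y (fun _ _ => False) = fun _ _ => False := by
  funext v w
  simp [residual]

theorem IsSynchronous.congr {R S : WordRel α β} (hR : IsSynchronous R)
    (h : ∀ v w, S v w ↔ R v w) : IsSynchronous S := by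
  have : S = R := by
    funext v w
    exact propext (h v w)
  rwa [this]

/-- The padding guards of a residual pass through `op` only if a failed guard leaves the value
false. This is the role of `hop`, and the reason for taking differences rather than complements. -/
theorem IsSynchronous.pointwise {R S : WordRel α β} (op : Prop → Prop → Prop)
    (hop : ¬ op False False) (hR : IsSynchronous R) (hS : IsSynchronous S) :
    IsSynchronous fun v w => op (R v w) (S v w) := by
  obtain ⟨F, hF, hRF, hFc⟩ := hR
  obtain ⟨G, hG, hSG, hGc⟩ := hS
  refine ⟨Set.image2 (fun A B v w => op (A v w) (B v w)) F G, hF.image2 _ hG,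
    ⟨R, hRF, S, hSG, rfl⟩, ?_⟩
  rintro _ ⟨A, hA, B, hB, rfl⟩ x y
  refine ⟨_, hFc A hA x y, _, hGc B hB x y, ?_⟩
  funext v w
  simp only [residual]
  generalize (x = none → v = []) = p, (y = none → w = []) = q
  by_cases h₁ : p <;> by_cases h₂ : q <;> simp [h₁, h₂, hop]

theorem IsSynchronous.and {R S : WordRel α β} (hR : IsSynchronous R) (hS : IsSynchronous S) :
    IsSynchronous fun v w => R v w ∧ S v w :=
  hR.pointwise And (by simp) hS

theorem IsSynchronous.or {R S : WordRel α β} (hR : IsSynchronous R) (hS : IsSynchronous S) :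
    IsSynchronous fun v w => R v w ∨ S v w :=
  hR.pointwise Or (by simp) hS

theorem IsSynchronous.diff {R S : WordRel α β} (hR : IsSynchronous R) (hS : IsSynchronous S) :
    IsSynchronous fun v w => R v w ∧ ¬ S v w :=
  hR.pointwise (fun p q => p ∧ ¬ q) (by simp) hS

theorem IsSynchronous.exists {ι : Type*} [Finite ι] {R : ι → WordRel α β}
    (hR : ∀ i, IsSynchronous (R i)) : IsSynchronous fun v w => ∃ i, R i v w := by
  choose F hF hRF hFc using hR
  refine ⟨(fun (g : ι → WordRel α β) v w => ∃ i, g i v w) '' Set.pi Set.univ F,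
    (Set.Finite.pi hF).image _,
    ⟨R, fun i _ => hRF i, rfl⟩, ?_⟩
  rintro _ ⟨g, hg, rfl⟩ x y
  refine ⟨fun i => residual x y (g i), fun i _ => hFc i _ (hg i (Set.mem_univ i)) x y, ?_⟩
  funext v w
  simp [residual]

theorem IsSynchronous.swap {R : WordRel α β} (hR : IsSynchronous R) :
    IsSynchronous fun w v => R v w := by
  obtain ⟨F, hF, hRF, hFc⟩ := hR
  refine ⟨(fun A w v => A v w) '' F, hF.image _, ⟨R, hRF, rfl⟩, ?_⟩
  rintro _ ⟨A, hA, rfl⟩ x y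
  refine ⟨_, hFc A hA y x, ?_⟩
  funext v w
  simp only [residual, eq_iff_iff]
  tauto

/-- Eliminating the middle word is a subset construction: its next letter is guessed, with `none`
for a word that has ended, and the members of the new family are indexed by sets of pairs from `F ×ˢ
G`. A middle word that outlasts both outer words causes no trouble, since the quantifier over it
stays inside the relation. -/
theorem IsSynchronous.comp {R : WordRel α β} {S : WordRel β γ} (hR : IsSynchronous R)
    (hS : IsSynchronous S) : IsSynchronous fun v w => ∃ u, R v u ∧ S u w := by
  obtain ⟨F, hF, hRF, hFc⟩ := hR
  obtain ⟨G, hG, hSG, hGc⟩ := hS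
  refine ⟨(fun (P : Set (WordRel α β × WordRel β γ)) v w => ∃ p ∈ P, ∃ u, p.1 v u ∧ p.2 u w) ''
    𝒫 (F ×ˢ G), (hF.prod hG).finite_subsets.image _, ⟨{(R, S)}, ?_, ?_⟩, ?_⟩
  · rintro _ rfl
    exact ⟨hRF, hSG⟩
  · funext v w
    simp
  rintro _ ⟨P, hP, rfl⟩ x y
  refine ⟨{q | ∃ p ∈ P, ∃ z, q = (residual x z p.1, residual z y p.2)}, ?_, ?_⟩
  · rintro _ ⟨p, hp, z, rfl⟩
    exact ⟨hFc _ (hP hp).1 x z, hGc _ (hP hp).2 z y⟩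
  · funext v w
    simp only [residual, eq_iff_iff]
    constructor
    · rintro ⟨_, ⟨p, hp, z, rfl⟩, u, ⟨h₁, -, h₃⟩, -, h₄, h₅⟩
      exact ⟨h₁, h₄, p, hp, _, h₃, h₅⟩
    · rintro ⟨h₁, h₂, p, hp, u, h₃, h₄⟩
      cases u with
      | nil => exact ⟨_, ⟨p, hp, none, rfl⟩, [], ⟨h₁, by simp, h₃⟩, by simp, h₂, h₄⟩
      | cons b u => exact ⟨_, ⟨p, hp, some b, rfl⟩, u, ⟨h₁, by simp, h₃⟩, by simp, h₂, h₄⟩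

/-- A finite family of relations that is closed under removing first letters consists of
synchronous relations. -/
theorem IsSynchronous.of_family {ι : Type*} [Finite ι] (F : ι → WordRel α β)
    (hcc : ∀ i a b, ∃ j, ∀ v w, F i (a :: v) (b :: w) ↔ F j v w)
    (hcn : ∀ i a, ∃ j, ∀ v, F i (a :: v) [] ↔ F j v [])
    (hnc : ∀ i b, ∃ j, ∀ w, F i [] (b :: w) ↔ F j [] w) (i : ι) : IsSynchronous (F i) := by
  -- The two flags record that the left or right word has already ended, after which a further
  -- letter on that side leads to the empty relation.
  let g : ι × Bool × Bool → WordRel α β := fun p v w =>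
    (p.2.1 = true → v = []) ∧ (p.2.2 = true → w = []) ∧ F p.1 v w
  refine ⟨insert (fun _ _ => False) (Set.range g), (Set.finite_range g).insert _,
    Or.inr ⟨(i, false, false), ?_⟩, ?_⟩
  · funext v w
    simp [g]
  rintro S (rfl | ⟨⟨i, p, q⟩, rfl⟩) x y
  · exact Or.inl (residual_bot x y)
  match x, y with
  | none, none =>
    refine Or.inr ⟨(i, true, true), ?_⟩
    funext v w
    simp only [g, residual, eq_iff_iff]
    constructor
    · rintro ⟨h₁, h₂, h₃⟩
      simpa [h₁, h₂] using h₃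
    · rintro ⟨h₁, h₂, -, -, h₃⟩
      simpa [h₁, h₂] using h₃
  | some a, none =>
    obtain ⟨j, hj⟩ := hcn i a
    cases p with
    | true =>
      refine Or.inl ?_
      funext v w
      simp [g, residual]
    | false =>
      refine Or.inr ⟨(j, false, true), ?_⟩
      funext v w
      simp only [g, residual, eq_iff_iff]
      constructor
      · rintro ⟨-, h₂, h₃⟩
        obtain rfl := h₂ trivial
        simpa [hj] using h₃
      · rintro ⟨-, h₂, -, -, h₃⟩
        obtain rfl := h₂ trivial
        simpa [hj] using h₃
  | none, some b =>
    obtain ⟨j, hj⟩ := hnc i b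
    cases q with
    | true =>
      refine Or.inl ?_
      funext v w
      simp [g, residual]
    | false =>
      refine Or.inr ⟨(j, true, false), ?_⟩
      funext v w
      simp only [g, residual, eq_iff_iff]
      constructor
      · rintro ⟨h₁, -, h₃⟩
        obtain rfl := h₁ trivial
        simpa [hj] using h₃
      · rintro ⟨h₁, -, -, -, h₃⟩
        obtain rfl := h₁ trivial
        simpa [hj] using h₃
  | some a, some b =>
    obtain ⟨j, hj⟩ := hcc i a b
    by_cases h : p = true ∨ q = true
    · refine Or.inl ?_
      funext v w
      rcases h with rfl | rfl <;> simp [g, residual]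
    · refine Or.inr ⟨(j, false, false), ?_⟩
      funext v w
      simp only [not_or, Bool.not_eq_true] at h
      simp [g, residual, h, hj]

theorem isSynchronous_top : IsSynchronous (fun _ _ => True : WordRel α β) :=
  IsSynchronous.of_family (ι := Unit) (fun _ _ _ => True) (fun i _ _ => ⟨i, by simp⟩)
    (fun i _ => ⟨i, by simp⟩) (fun i _ => ⟨i, by simp⟩) ()

theorem isSynchronous_bot : IsSynchronous (fun _ _ => False : WordRel α β) :=
  IsSynchronous.of_family (ι := Unit) (fun _ _ _ => False) (fun i _ _ => ⟨i, by simp⟩)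
    (fun i _ => ⟨i, by simp⟩) (fun i _ => ⟨i, by simp⟩) ()

theorem isSynchronous_nil : IsSynchronous (fun v w => v = [] ∧ w = [] : WordRel α β) :=
  IsSynchronous.of_family (ι := Bool) (fun i v w => i = true ∧ v = [] ∧ w = [])
    (fun _ _ _ => ⟨false, by simp⟩) (fun _ _ => ⟨false, by simp⟩)
    (fun _ _ => ⟨false, by simp⟩) true |>.congr (by simp)

/-- Words whose lengths differ by `n`. -/
theorem isSynchronous_length (n : ℕ) :
    IsSynchronous (fun v w => v.length = w.length + n : WordRel α β) := by
  -- The index `some k` is the surplus length still owed by the left word; `none` is the dead state.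
  have h := IsSynchronous.of_family (α := α) (β := β) (ι := Option (Fin (n + 1)))
    (fun i v w => ∃ k, i = some k ∧ v.length = w.length + k) (fun i _ _ => ⟨i, by
      intro v w
      simp only [List.length_cons]
      refine exists_congr fun k => and_congr_right fun _ => ?_
      omega⟩) (fun i _ => by
      rcases i with _ | ⟨_ | k, hk⟩
      · exact ⟨none, by simp⟩
      · exact ⟨none, by simp⟩
      · exact ⟨some ⟨k, by omega⟩, by simp⟩)
      (fun _ _ => ⟨none, by simp; omega⟩) (some (Fin.last n))
  exact h.congr (by simp)

/-- The diagonal of the words all of whose letters satisfy `p`. -/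
theorem isSynchronous_diag_forall (p : α → Prop) :
    IsSynchronous fun v w : List α => v = w ∧ ∀ x ∈ v, p x := by
  classical
  have h := IsSynchronous.of_family (α := α) (β := α) (ι := Bool)
    (fun i v w => i = true ∧ v = w ∧ ∀ x ∈ v, p x)
    (fun i a b => ⟨i && decide (a = b ∧ p a), fun v w => by simp; tauto⟩)
    (fun _ _ => ⟨false, by simp⟩) (fun _ _ => ⟨false, by simp⟩) true
  exact h.congr (by simp)

theorem isSynchronous_eq : IsSynchronous (fun v w => v = w : WordRel α α) :=
  (isSynchronous_diag_forall fun _ => True).congr (by simp)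

/-- Until the words differ, nothing is decided. At the first difference only a comparison of lengths
remains: `≤` if the left letter is smaller, `<` otherwise. -/
theorem isSynchronous_shortlex (r : α → α → Prop) : IsSynchronous (List.Shortlex r) := by
  classical
  let F : Fin 4 → WordRel α α := ![fun _ _ => False, fun v w => v.length < w.length,
    fun v w => v.length ≤ w.length, List.Shortlex r]
  refine IsSynchronous.of_family F (fun i a b => ?_) (fun i a => ?_) (fun i b => ?_) 3
  · fin_cases i
    · exact ⟨0, by simp [F]⟩
    · exact ⟨1, by simp [F]⟩
    · exact ⟨2, by simp [F]⟩
    · by_cases h : r a b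
      · refine ⟨2, fun v w => ?_⟩
        simp [F, List.shortlex_def, List.Lex.rel h, Nat.le_iff_lt_or_eq]
      · by_cases hab : a = b
        · subst hab
          refine ⟨3, fun v w => ?_⟩
          have : List.Lex r (a :: v) (a :: w) ↔ List.Lex r v w :=
            ⟨fun hl => by cases hl with
              | cons h' => exact h'
              | rel h' => exact absurd h' h, List.Lex.cons⟩
          simp [F, List.shortlex_def, this]
        · refine ⟨1, fun v w => ?_⟩
          have : ¬ List.Lex r (a :: v) (b :: w) := fun hl => by
            cases hl with
            | cons h' => exact hab rfl
            | rel h' => exact h h'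
          simp [F, List.shortlex_def, this]
  · refine ⟨0, fun v => ?_⟩
    fin_cases i <;> simp [F]
  · fin_cases i
    · exact ⟨0, by simp [F]⟩
    all_goals refine ⟨2, fun w => ?_⟩; simp [F, List.shortlex_def]

/-- Prefixing a relation by one letter on each side. -/
theorem IsSynchronous.cons {R : WordRel α β} (hR : IsSynchronous R) (a : α) (b : β) :
    IsSynchronous fun v w => ∃ v' w', v = a :: v' ∧ w = b :: w' ∧ R v' w' := by
  obtain ⟨F, hF, hRF, hFc⟩ := hR
  refine ⟨insert (fun v w => ∃ v' w', v = a :: v' ∧ w = b :: w' ∧ R v' w')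
    (insert (fun _ _ => False) F), (hF.insert _).insert _, Or.inl rfl, ?_⟩
  rintro S (rfl | rfl | hS) x y
  · by_cases h : x = some a ∧ y = some b
    · obtain ⟨rfl, rfl⟩ := h
      refine Or.inr (Or.inr ?_)
      convert hRF using 1
      funext v w
      simp [residual]
    · refine Or.inr (Or.inl ?_)
      funext v w
      simp only [residual, eq_iff_iff, iff_false]
      rintro ⟨h₁, h₂, v', w', h₃, h₄, -⟩
      rcases x with _ | x <;> rcases y with _ | y <;> simp_all
  · exact Or.inr (Or.inl (residual_bot x y))
  · exact Or.inr (Or.inr (hFc S hS x y))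

theorem toList_append_eq_map {δ δ' : Type*} {k : δ → δ'} {z : Option δ'} {s : List δ'}
    {s' : List δ} (h : z.toList ++ s = s'.map k) :
    ∃ z' t, z = Option.map k z' ∧ s = t.map k ∧ s' = z'.toList ++ t := by
  cases z with
  | none => exact ⟨none, s', rfl, by simpa using h, by simp⟩
  | some c =>
    cases s' with
    | nil => simp at h
    | cons c' s' =>
      simp only [Option.toList_some, List.singleton_append, List.map_cons, List.cons.injEq] at h
      exact ⟨some c', s', by simp [h.1], h.2, by simp⟩

/-- Applying injective maps to the letters. -/
theorem IsSynchronous.map {α' β' : Type*} {R : WordRel α β} (hR : IsSynchronous R) {f : α → α'}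
    {g : β → β'} (hf : f.Injective) (hg : g.Injective) :
    IsSynchronous fun v w => ∃ v' w', v = v'.map f ∧ w = w'.map g ∧ R v' w' := by
  obtain ⟨F, hF, hRF, hFc⟩ := hR
  let G : WordRel α β → WordRel α' β' := fun S v w => ∃ v' w', v = v'.map f ∧ w = w'.map g ∧ S v' w'
  refine ⟨insert (fun _ _ => False) (G '' F), (hF.image _).insert _, Or.inr ⟨R, hRF, rfl⟩, ?_⟩
  rintro _ (rfl | ⟨S, hS, rfl⟩) x y
  · exact Or.inl (residual_bot x y)
  by_cases h : ∃ x' y', x = Option.map f x' ∧ y = Option.map g y'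
  · obtain ⟨x, y, rfl, rfl⟩ := h
    refine Or.inr ⟨_, hFc S hS x y, ?_⟩
    funext v w
    simp only [G, residual, eq_iff_iff, Option.map_eq_none_iff]
    constructor
    · rintro ⟨v, w, rfl, rfl, h₁, h₂, h₃⟩
      refine ⟨by simpa using h₁, by simpa using h₂, _, _, ?_, ?_, h₃⟩
      · cases x <;> simp
      · cases y <;> simp
    · rintro ⟨h₁, h₂, v', w', h₃, h₄, h₅⟩
      obtain ⟨x', t, hx, rfl, rfl⟩ := toList_append_eq_map h₃
      obtain ⟨y', t', hy, rfl, rfl⟩ := toList_append_eq_map h₄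
      obtain rfl := Option.map_injective hf hx
      obtain rfl := Option.map_injective hg hy
      exact ⟨t, t', rfl, rfl, by simpa using h₁, by simpa using h₂, h₅⟩
  · refine Or.inl ?_
    funext v w
    simp only [G, residual, eq_iff_iff, iff_false]
    rintro ⟨-, -, v', w', h₃, h₄, -⟩
    apply h
    obtain ⟨x', -, hx, -⟩ := toList_append_eq_map h₃
    obtain ⟨y', -, hy, -⟩ := toList_append_eq_map h₄
    exact ⟨x', y', hx, hy⟩

/-- Prefixing a relation by a common word all of whose letters satisfy `p`. -/
theorem IsSynchronous.prepend {R : WordRel α α} (hR : IsSynchronous R) (p : α → Prop) :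
    IsSynchronous fun v w =>
      ∃ u v' w', (∀ x ∈ u, p x) ∧ v = u ++ v' ∧ w = u ++ w' ∧ R v' w' := by
  classical
  obtain ⟨F, hF, hRF, hFc⟩ := hR
  let P : WordRel α α := fun v w =>
    ∃ u v' w', (∀ x ∈ u, p x) ∧ v = u ++ v' ∧ w = u ++ w' ∧ R v' w'
  -- A letter either extends the common prefix or is the first letter read by `R`. The choice is
  -- nondeterministic, hence the sets of residuals in `G` below, with a proposition telling whether
  -- the prefix may still be running.
  have hP : ∀ x y v w, residual x y P v w ↔
      (∃ a, x = some a ∧ y = some a ∧ p a ∧ P v w) ∨ residual x y R v w := by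
    intro x y v w
    constructor
    · rintro ⟨h₁, h₂, u, v', w', h₃, h₄, h₅, h₆⟩
      cases u with
      | nil =>
        simp only [List.nil_append] at h₄ h₅
        subst h₄ h₅
        exact Or.inr ⟨h₁, h₂, h₆⟩
      | cons c u =>
        rcases x with _ | x
        · simp [h₁ rfl] at h₄
        rcases y with _ | y
        · simp [h₂ rfl] at h₅
        simp only [Option.toList_some, List.cons_append, List.cons.injEq] at h₄ h₅
        obtain ⟨rfl, rfl⟩ := h₄
        obtain ⟨rfl, rfl⟩ := h₅
        exact Or.inl ⟨_, rfl, rfl, h₃ _ (by simp), u, v', w', fun x hx => h₃ x (by simp [hx]),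
          rfl, rfl, h₆⟩
    · rintro (⟨a, rfl, rfl, ha, u, v', w', h₃, rfl, rfl, h₆⟩ | ⟨h₁, h₂, h₃⟩)
      · exact ⟨by simp, by simp, a :: u, v', w', by simpa [ha] using h₃, by simp, by simp, h₆⟩
      · exact ⟨h₁, h₂, [], _, _, by simp, rfl, rfl, h₃⟩
  let G : Prop × Set (WordRel α α) → WordRel α α := fun q v w =>
    (q.1 ∧ P v w) ∨ ∃ S ∈ q.2, S v w
  refine ⟨G '' (Set.univ ×ˢ 𝒫 F), (Set.finite_univ.prod hF.finite_subsets).image _,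
    ⟨(True, ∅), by simp, ?_⟩, ?_⟩
  · funext v w
    simp [G, P]
  rintro _ ⟨⟨b, T⟩, ⟨-, hT⟩, rfl⟩ x y
  refine ⟨(b ∧ ∃ a, x = some a ∧ y = some a ∧ p a,
    {S | (b ∧ S = residual x y R) ∨ ∃ S' ∈ T, S = residual x y S'}), ⟨trivial, ?_⟩, ?_⟩
  · rintro S (⟨-, rfl⟩ | ⟨S', hS', rfl⟩)
    · exact hFc R hRF x y
    · exact hFc S' (hT hS') x y
  · funext v w
    have h₁ : residual x y (G (b, T)) v w ↔
        (b ∧ residual x y P v w) ∨ ∃ S ∈ T, residual x y S v w := by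
      simp only [G, residual]
      constructor
      · rintro ⟨h₁, h₂, ⟨h₃, h₄⟩ | ⟨S, hS, h₃⟩⟩
        · exact Or.inl ⟨h₃, h₁, h₂, h₄⟩
        · exact Or.inr ⟨S, hS, h₁, h₂, h₃⟩
      · rintro (⟨h₃, h₁, h₂, h₄⟩ | ⟨S, hS, h₁, h₂, h₃⟩)
        · exact ⟨h₁, h₂, Or.inl ⟨h₃, h₄⟩⟩
        · exact ⟨h₁, h₂, Or.inr ⟨S, hS, h₃⟩⟩
    rw [eq_iff_iff, h₁, hP]
    simp only [G, Set.mem_ofPred_eq]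
    constructor
    · rintro (⟨⟨hb, a, h⟩, h'⟩ | ⟨S, ⟨hb, rfl⟩ | ⟨S', hS', rfl⟩, h⟩)
      · exact Or.inl ⟨hb, Or.inl ⟨a, h.1, h.2.1, h.2.2, h'⟩⟩
      · exact Or.inl ⟨hb, Or.inr h⟩
      · exact Or.inr ⟨S', hS', h⟩
    · rintro (⟨hb, ⟨a, h1, h2, h3, h4⟩ | h⟩ | ⟨S, hS, h⟩)
      · exact Or.inl ⟨⟨hb, a, h1, h2, h3⟩, h4⟩
      · exact Or.inr ⟨_, Or.inl ⟨hb, rfl⟩, h⟩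
      · exact Or.inr ⟨_, Or.inr ⟨S, hS, rfl⟩, h⟩

end Synchronous

/-! ### Synchronous relations and regular relations -/

section Regular

variable {A : Type*}

/-- The convolution of two words. -/
def conv₂ : List A → List A → List (Option A × Option A)
  | [], [] => []
  | a :: v, [] => (some a, none) :: conv₂ v []
  | [], b :: w => (none, some b) :: conv₂ [] w
  | a :: v, b :: w => (some a, some b) :: conv₂ v w

theorem conv₂_append (v w : List A) (x y : Option A) (hx : x = none → v = [])
    (hy : y = none → w = []) (h : ¬ (x = none ∧ y = none)) :
    conv₂ (x.toList ++ v) (y.toList ++ w) = (x, y) :: conv₂ v w := by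
  rcases x with _ | a <;> rcases y with _ | b
  · simp at h
  · obtain rfl := hx rfl
    simp [conv₂]
  · obtain rfl := hy rfl
    simp [conv₂]
  · simp [conv₂]

theorem conv₂_eq_nil {v w : List A} : conv₂ v w = [] ↔ v = [] ∧ w = [] := by
  rcases v with _ | ⟨a, v⟩ <;> rcases w with _ | ⟨b, w⟩ <;> simp [conv₂]

theorem conv₂_eq_cons {v w : List A} {x y : Option A} {l : List (Option A × Option A)}
    (h : conv₂ v w = (x, y) :: l) :
    ¬ (x = none ∧ y = none) ∧ ∃ v' w', (x = none → v' = []) ∧ (y = none → w' = []) ∧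
      v = x.toList ++ v' ∧ w = y.toList ++ w' ∧ conv₂ v' w' = l := by
  rcases v with _ | ⟨a, v⟩ <;> rcases w with _ | ⟨b, w⟩ <;>
    simp only [conv₂, List.cons.injEq, Prod.mk.injEq, reduceCtorEq] at h
  · obtain ⟨⟨rfl, rfl⟩, rfl⟩ := h
    exact ⟨by simp, [], w, by simp⟩
  · obtain ⟨⟨rfl, rfl⟩, rfl⟩ := h
    exact ⟨by simp, v, [], by simp⟩
  · obtain ⟨⟨rfl, rfl⟩, rfl⟩ := h
    exact ⟨by simp, v, w, by simp⟩

theorem conv₂_getElem? (v w : List A) (j : ℕ) :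
    (conv₂ v w)[j]? = if j < max v.length w.length then some (v[j]?, w[j]?) else none := by
  induction j generalizing v w with
  | zero => rcases v with _ | ⟨a, v⟩ <;> rcases w with _ | ⟨b, w⟩ <;> simp [conv₂]
  | succ j ih =>
    rcases v with _ | ⟨a, v⟩ <;> rcases w with _ | ⟨b, w⟩ <;> simp [conv₂, ih]

theorem conv_eq_map_conv₂ (w : Fin 2 → List A) :
    conv w = (conv₂ (w 0) (w 1)).map fun p => ![p.1, p.2] := by
  refine List.ext_getElem? fun j => ?_
  have hm : (Finset.univ.sup fun i => (w i).length) = max (w 0).length (w 1).length := by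
    rw [Fin.univ_succ]
    simp
  rw [List.getElem?_map, conv₂_getElem?, ← hm, conv, List.getElem?_ofFn]
  split_ifs with h
  · simp only [Option.map_some, Option.some.injEq]
    funext i
    fin_cases i <;> rfl
  · rfl

theorem vec_injective : Function.Injective fun p : A × A => ![p.1, p.2] := by
  rintro ⟨a, b⟩ ⟨c, d⟩ h
  exact Prod.ext (congrFun h 0) (congrFun h 1)

theorem conv₂_injective {v w v' w' : List A} (h : conv₂ v w = conv₂ v' w') :
    v = v' ∧ w = w' := by
  have key : ∀ j : ℕ, v[j]? = v'[j]? ∧ w[j]? = w'[j]? := by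
    intro j
    have hj := congrArg (·[j]?) h
    simp only [conv₂_getElem?] at hj
    split_ifs at hj with h₁ h₂ h₂
    · simpa using hj
    · simp only [lt_sup_iff, not_or, not_lt] at h₁ h₂
      simp [h₁.1, h₁.2, h₂.1, h₂.2]
  exact ⟨List.ext_getElem? fun j => (key j).1, List.ext_getElem? fun j => (key j).2⟩

theorem conv_injective : Function.Injective (conv : (Fin 2 → List A) → _) := by
  intro v w h
  rw [conv_eq_map_conv₂, conv_eq_map_conv₂] at h
  obtain ⟨h₀, h₁⟩ := conv₂_injective (List.map_injective_iff.2 vec_injective h)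
  funext i
  fin_cases i
  · exact h₀
  · exact h₁

/-- The automaton whose states are the members of a family closed under residuals. -/
def residualDFA (F : Set (WordRel A A)) (hF : ∀ S ∈ F, ∀ x y, residual x y S ∈ F)
    (hbot : (fun _ _ => False) ∈ F) (R : F) : DFA (Fin 2 → Option A) F where
  step S p :=
    -- The pair of two paddings occurs in no convolution and must be rejected, although the residual
    -- by it need not be empty.
    open Classical in
    if p 0 = none ∧ p 1 = none then ⟨_, hbot⟩ else ⟨_, hF S.1 S.2 (p 0) (p 1)⟩
  start := R
  accept := {S | S.1 [] []}

theorem residualDFA_evalFrom {F : Set (WordRel A A)} (hF : ∀ S ∈ F, ∀ x y, residual x y S ∈ F)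
    (hbot : (fun _ _ => False) ∈ F) (R S : F) (l : List (Option A × Option A)) :
    ((residualDFA F hF hbot R).evalFrom S (l.map fun p => ![p.1, p.2])).1 [] [] ↔
      ∃ v w, conv₂ v w = l ∧ S.1 v w := by
  induction l generalizing S with
  | nil => simp [conv₂_eq_nil]
  | cons p l ih =>
    obtain ⟨x, y⟩ := p
    rw [List.map_cons, DFA.evalFrom_cons, ih]
    constructor
    · rintro ⟨v, w, rfl, h⟩
      by_cases hn : x = none ∧ y = none
      · simp [residualDFA, hn] at h
      · obtain ⟨h₁, h₂, h₃⟩ : residual x y S.1 v w := by simpa [residualDFA, hn] using h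
        exact ⟨_, _, conv₂_append v w x y h₁ h₂ hn, h₃⟩
    · rintro ⟨v, w, h, hS⟩
      obtain ⟨hn, v', w', h₁, h₂, rfl, rfl, h₃⟩ := conv₂_eq_cons h
      refine ⟨v', w', h₃, ?_⟩
      simpa [residualDFA, hn] using ⟨h₁, h₂, hS⟩

theorem exists_map_vec (l : List (Fin 2 → Option A)) :
    ∃ l' : List (Option A × Option A), l = l'.map fun p => ![p.1, p.2] := by
  refine ⟨l.map fun f => (f 0, f 1), ?_⟩
  rw [List.map_map]
  conv_lhs => rw [← List.map_id l]
  refine List.map_congr_left fun f _ => ?_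
  funext i
  fin_cases i <;> rfl

theorem IsSynchronous.isRegularRel {R : WordRel A A} (hR : IsSynchronous R) :
    IsRegularRel {w : Fin 2 → List A | R (w 0) (w 1)} := by
  obtain ⟨F, hF, hRF, hFc⟩ := hR
  let G := insert (fun _ _ => False) F
  have hG : G.Finite := hF.insert _
  have hGc : ∀ S ∈ G, ∀ x y, residual x y S ∈ G := by
    rintro S (rfl | hS) x y
    · exact Or.inl (residual_bot x y)
    · exact Or.inr (hFc S hS x y)
  have := hG.fintype
  let M := residualDFA G hGc (Or.inl rfl) ⟨R, Or.inr hRF⟩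
  refine Language.isRegular_iff.2 ⟨G, this, M, ?_⟩
  ext l
  obtain ⟨l, rfl⟩ := exists_map_vec l
  refine (residualDFA_evalFrom hGc (Or.inl rfl) _ _ l).trans ?_
  constructor
  · rintro ⟨v, w, rfl, h⟩
    exact ⟨![v, w], h, conv_eq_map_conv₂ _⟩
  · rintro ⟨w, hw, h⟩
    rw [conv_eq_map_conv₂] at h
    exact ⟨w 0, w 1, List.map_injective_iff.2 vec_injective h, hw⟩

/-- Each state of an automaton gives the relation accepted from that state, and reading a pair of
letters only changes the state. -/
theorem isSynchronous_of_isRegularRel {S : Set (Fin 2 → List A)} (hS : IsRegularRel S) :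
    IsSynchronous fun v w => ![v, w] ∈ S := by
  obtain ⟨σ, _, M, hM⟩ := hS
  have h := IsSynchronous.of_family (ι := σ)
    (fun s v w => M.evalFrom s (conv ![v, w]) ∈ M.accept)
    (fun s a b => ⟨M.step s ![some a, some b], fun v w => by simp [conv_eq_map_conv₂, conv₂]⟩)
    (fun s a => ⟨M.step s ![some a, none], fun v => by simp [conv_eq_map_conv₂, conv₂]⟩)
    (fun s b => ⟨M.step s ![none, some b], fun w => by simp [conv_eq_map_conv₂, conv₂]⟩) M.start
  refine h.congr fun v w => ?_
  change _ ↔ conv ![v, w] ∈ M.accepts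
  rw [hM]
  exact conv_injective.mem_set_image.symm

/-- The language of the words related to themselves by a synchronous relation is regular. -/
theorem IsSynchronous.isRegular_diag {R : WordRel A A} (hR : IsSynchronous R) :
    Language.IsRegular ({w | R w w} : Language A) := by
  obtain ⟨F, hF, hRF, hFc⟩ := hR
  have := hF.fintype
  let M : DFA A F :=
    ⟨fun S a => ⟨_, hFc S.1 S.2 (some a) (some a)⟩, ⟨R, hRF⟩, {S | S.1 [] []}⟩
  have key : ∀ (l : List A) (S : F), M.evalFrom S l ∈ M.accept ↔ S.1 l l := by
    intro l
    induction l with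
    | nil => exact fun S => Iff.rfl
    | cons a l ih =>
      intro S
      rw [DFA.evalFrom_cons, ih]
      simp [M, residual]
  refine Language.isRegular_iff.2 ⟨F, this, M, ?_⟩
  ext l
  exact key l _

end Regular

/-! ### Some synchronous relations -/

section Basic

variable {α β : Type*}

theorem isSynchronous_right_nil : IsSynchronous (fun _ w => w = [] : WordRel α β) :=
  (IsSynchronous.of_family (ι := Bool) (fun i _ w => i = true ∧ w = [])
    (fun _ _ _ => ⟨false, by simp⟩) (fun i _ => ⟨i, by simp⟩)
    (fun _ _ => ⟨false, by simp⟩) true).congr (by simp)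

theorem isSynchronous_left_nil : IsSynchronous (fun v _ => v = [] : WordRel α β) :=
  isSynchronous_right_nil.swap

/-- Inserting a first letter. -/
theorem isSynchronous_shift [Finite α] (s : α) :
    IsSynchronous (fun v w => w = s :: v : WordRel α α) := by
  classical
  -- The right word lags by one letter, so the pending letter is remembered: dead, finished, or `t`
  -- pending. Finiteness of the alphabet enters here.
  let F : Option (Option α) → WordRel α α
    | none => fun _ _ => False
    | some none => fun v w => v = [] ∧ w = []
    | some (some t) => fun v w => w = t :: v
  refine IsSynchronous.of_family F (fun i a b => ?_) (fun i a => ⟨none, fun v => ?_⟩)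
    (fun i b => ?_) (some (some s))
  · rcases i with _ | _ | t
    · exact ⟨none, by simp [F]⟩
    · exact ⟨none, by simp [F]⟩
    · refine ⟨if b = t then some (some a) else none, fun v w => ?_⟩
      split_ifs with h <;> simp [F, h]
  · rcases i with _ | _ | t <;> simp [F]
  · rcases i with _ | _ | t
    · exact ⟨none, by simp [F]⟩
    · exact ⟨none, by simp [F]⟩
    · refine ⟨if b = t then some none else none, fun w => ?_⟩
      split_ifs with h <;> simp [F, h]

theorem forall_mem_inl_iff {B Q : Type*} {p : B → Prop} {l : List (B ⊕ Q)} :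
    (∀ x ∈ l, ∃ b, x = Sum.inl b ∧ p b) ↔ ∃ t : List B, l = t.map Sum.inl ∧ ∀ b ∈ t, p b := by
  constructor
  · intro h
    induction l with
    | nil => exact ⟨[], by simp⟩
    | cons x l ih =>
      obtain ⟨t, rfl, ht⟩ := ih fun x hx => h x (by simp [hx])
      obtain ⟨b, rfl, hb⟩ := h x (by simp)
      exact ⟨b :: t, by simp, by simpa [hb] using ht⟩
  · rintro ⟨t, rfl, ht⟩ x hx
    obtain ⟨b, hb, rfl⟩ := List.mem_map.1 hx
    exact ⟨b, rfl, ht b hb⟩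

theorem IsSynchronous.prepend_inl {B Q : Type*} {R : WordRel (B ⊕ Q) (B ⊕ Q)}
    (hR : IsSynchronous R) (p : B → Prop) :
    IsSynchronous fun v w => ∃ (u : List B) (v' w' : List (B ⊕ Q)), (∀ x ∈ u, p x) ∧
      v = u.map Sum.inl ++ v' ∧ w = u.map Sum.inl ++ w' ∧ R v' w' := by
  refine (hR.prepend fun x => ∃ b, x = Sum.inl b ∧ p b).congr fun v w => ?_
  simp only [forall_mem_inl_iff]
  constructor
  · rintro ⟨u, v', w', h₁, h₂, h₃, h₄⟩
    exact ⟨_, v', w', ⟨u, rfl, h₁⟩, h₂, h₃, h₄⟩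
  · rintro ⟨_, v', w', ⟨u, rfl, h₁⟩, h₂, h₃, h₄⟩
    exact ⟨u, v', w', h₁, h₂, h₃, h₄⟩

theorem isSynchronous_diag_inl {B Q : Type*} (p : B → Prop) :
    IsSynchronous fun v w : List (B ⊕ Q) =>
      ∃ t : List B, (∀ x ∈ t, p x) ∧ v = t.map Sum.inl ∧ w = t.map Sum.inl := by
  refine (isSynchronous_diag_forall fun x => ∃ b, x = Sum.inl b ∧ p b).congr fun v w => ?_
  simp only [forall_mem_inl_iff]
  constructor
  · rintro ⟨t, h, rfl, rfl⟩
    exact ⟨rfl, t, rfl, h⟩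
  · rintro ⟨rfl, t, rfl, h⟩
    exact ⟨t, h, rfl, rfl⟩

end Basic

/-! ### Binary numbers, least significant bit first -/

section Binary

def bitVal : List Bool → ℕ
  | [] => 0
  | b :: l => b.toNat + 2 * bitVal l

theorem bitVal_lt (l : List Bool) : bitVal l < 2 ^ l.length := by
  induction l with
  | nil => simp [bitVal]
  | cons b l ih =>
    have := b.toNat_le
    simp only [bitVal, List.length_cons, pow_succ]
    omega

theorem exists_bitVal (i x : ℕ) (hx : x < 2 ^ i) : ∃ l, l.length = i ∧ bitVal l = x := by
  induction i generalizing x with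
  | zero => exact ⟨[], rfl, by simp at hx; simp [bitVal, hx]⟩
  | succ i ih =>
    obtain ⟨l, hl, h⟩ := ih (x / 2) (by rw [pow_succ] at hx; omega)
    refine ⟨decide (x % 2 = 1) :: l, by simp [hl], ?_⟩
    rw [bitVal, h]
    rcases Nat.mod_two_eq_zero_or_one x with h | h <;> simp [h] <;> omega

/-- The value is maximal for its length exactly when all bits are one. -/
theorem isSynchronous_bitVal_max {α : Type*} :
    IsSynchronous (fun _ l => bitVal l + 1 = 2 ^ l.length : WordRel α Bool) := by
  have key : ∀ b l, bitVal (b :: l) + 1 = 2 ^ (b :: l).length ↔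
      b = true ∧ bitVal l + 1 = 2 ^ l.length := by
    intro b l
    simp only [bitVal, List.length_cons, pow_succ]
    cases b <;> simp <;> omega
  refine (IsSynchronous.of_family (ι := Bool)
    (fun i _ l => i = true ∧ bitVal l + 1 = 2 ^ l.length) (fun i a b => ⟨i && b, fun v w => ?_⟩)
    (fun i _ => ⟨i, by simp⟩) (fun i b => ⟨i && b, fun w => ?_⟩) true).congr (by simp)
  · rw [key]
    simp [and_assoc]
  · rw [key]
    simp [and_assoc]

theorem isSynchronous_bitVal_succ :
    IsSynchronous fun l l' => l.length = l'.length ∧ bitVal l = bitVal l' + 1 := by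
  -- With the least significant bit first, the borrow travels in the reading direction; the states
  -- are dead, no borrow, and borrow pending.
  let F : Fin 3 → WordRel Bool Bool := ![fun _ _ => False,
    fun l l' => l.length = l'.length ∧ bitVal l = bitVal l',
    fun l l' => l.length = l'.length ∧ bitVal l = bitVal l' + 1]
  refine IsSynchronous.of_family F (fun i a b => ?_) (fun i a => ⟨0, fun v => ?_⟩)
    (fun i b => ⟨0, fun v => ?_⟩) 2
  · fin_cases i
    · exact ⟨0, by simp [F]⟩
    · cases a <;> cases b
      · exact ⟨1, fun v w => by simp [F, bitVal]⟩
      · exact ⟨0, fun v w => by simp [F, bitVal]; omega⟩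
      · exact ⟨0, fun v w => by simp [F, bitVal]; omega⟩
      · exact ⟨1, fun v w => by simp [F, bitVal]⟩
    · cases a <;> cases b
      · exact ⟨0, fun v w => by simp [F, bitVal]; omega⟩
      · exact ⟨2, fun v w => by simp [F, bitVal]; omega⟩
      · exact ⟨1, fun v w => by simp [F, bitVal]; omega⟩
      · exact ⟨0, fun v w => by simp [F, bitVal]; omega⟩
  · fin_cases i <;> simp [F]
  · fin_cases i <;> simp [F]

theorem isSynchronous_bitVal_zero {β : Type*} :
    IsSynchronous (fun l w => bitVal l = 0 ∧ w = [] : WordRel Bool β) :=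
  (IsSynchronous.of_family (ι := Bool) (fun i l w => i = true ∧ bitVal l = 0 ∧ w = [])
    (fun _ _ _ => ⟨false, by simp⟩) (fun i b => ⟨i && !b, fun v => by
      cases b <;> simp [bitVal]⟩)
    (fun _ _ => ⟨false, by simp⟩) true).congr (by simp)

end Binary

/-! ### Synchronous relations between configurations -/

section Configurations

variable {B Q : Type}

theorem Config.word_injective : Function.Injective (Config.word : Config B Q → _) := by
  rintro ⟨u, q, v⟩ ⟨u', q', v'⟩ h
  simp only [Config.word] at h
  induction u generalizing u' with
  | nil =>
    cases u' with
    | nil =>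
      simp only [List.map_nil, List.nil_append, List.cons.injEq, Sum.inr.injEq] at h
      rw [h.1, List.map_injective_iff.2 Sum.inl_injective h.2]
    | cons b u' => simp at h
  | cons a u ih =>
    cases u' with
    | nil => simp at h
    | cons b u' =>
      simp only [List.map_cons, List.cons_append, List.cons.injEq, Sum.inl.injEq] at h
      have := ih u' h.2
      simp only [Config.mk.injEq] at this ⊢
      exact ⟨by rw [h.1, this.1], this.2⟩

/-- Such a partial identity serves to restrict other relations to configurations of a given kind, by
composition or difference. -/
theorem isSynchronous_config_diag [Finite Q] (p : B → Prop) (s : Q → Prop) :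
    IsSynchronous fun v w => ∃ c : Config B Q, (∀ x ∈ c.contents, p x) ∧ s c.q ∧
      v = c.word ∧ w = c.word := by
  have h := (IsSynchronous.exists fun q : {q // s q} =>
    (isSynchronous_diag_inl (Q := Q) p).cons (Sum.inr q.1) (Sum.inr q.1)).prepend_inl p
  refine h.congr fun v w => ?_
  constructor
  · rintro ⟨⟨u, q, t⟩, h₁, h₂, rfl, rfl⟩
    simp only [Config.contents, List.mem_append] at h₁
    exact ⟨u, _, _, fun x hx => h₁ x (Or.inl hx), rfl, rfl, ⟨q, h₂⟩, _, _, rfl, rfl, t,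
      fun x hx => h₁ x (Or.inr hx), rfl, rfl⟩
  · rintro ⟨u, _, _, hu, rfl, rfl, ⟨q, hq⟩, _, _, rfl, rfl, t, ht, rfl, rfl⟩
    refine ⟨⟨u, q, t⟩, fun x hx => ?_, hq, rfl, rfl⟩
    rcases List.mem_append.1 hx with hx | hx
    exacts [hu x hx, ht x hx]

theorem isSynchronous_config_eq [Finite Q] :
    IsSynchronous fun v w => ∃ c : Config B Q, v = c.word ∧ w = c.word :=
  (isSynchronous_config_diag (B := B) (Q := Q) (fun _ => True) fun _ => True).congr (by simp)

/-- Replacing the first letter, which must be `y` (or absent, if `y` is the blank). -/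
theorem isSynchronous_replace_head [Finite B] [Finite Q] (blank y : B) (s : B ⊕ Q) :
    IsSynchronous fun v w : List (B ⊕ Q) => ∃ t : List B, t.headD blank = y ∧
      v = t.map Sum.inl ∧ w = s :: t.tail.map Sum.inl := by
  have h₁ := (isSynchronous_diag_inl (Q := Q) fun _ : B => True).cons (Sum.inl y) s
  -- The head stands just after the written tape and reads an implicit blank.
  have h₂ : IsSynchronous fun v w : List (B ⊕ Q) => blank = y ∧ v = [] ∧ w = [s] := by
    by_cases hb : blank = y
    · refine (isSynchronous_left_nil.and (isSynchronous_shift s)).congr fun v w => ?_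
      constructor
      · rintro ⟨-, rfl, rfl⟩
        exact ⟨rfl, rfl⟩
      · rintro ⟨rfl, rfl⟩
        exact ⟨hb, rfl, rfl⟩
    · exact isSynchronous_bot.congr (by simp [hb])
  refine (h₁.or h₂).congr fun v w => ?_
  constructor
  · rintro ⟨t, ht, rfl, rfl⟩
    cases t with
    | nil => exact Or.inr ⟨ht, rfl, rfl⟩
    | cons z t =>
      obtain rfl : z = y := ht
      exact Or.inl ⟨_, _, rfl, rfl, t, by simp, rfl, rfl⟩
  · rintro (⟨_, _, rfl, rfl, t, -, rfl, rfl⟩ | ⟨h, rfl, rfl⟩)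
    · exact ⟨y :: t, rfl, rfl, rfl⟩
    · exact ⟨[], h, rfl, rfl⟩

theorem Machine.next_of_right {T : Machine B Q} {u v : List B} {q q' : Q} {b : B}
    (h : T.tr q (v.headD T.blank) = (q', b, .right)) :
    T.next ⟨u, q, v⟩ = ⟨u ++ [b], q', v.tail⟩ := by
  simp only [Machine.next, h]

theorem Machine.next_of_stay {T : Machine B Q} {u v : List B} {q q' : Q} {b : B}
    (h : T.tr q (v.headD T.blank) = (q', b, .stay)) :
    T.next ⟨u, q, v⟩ = ⟨u, q', b :: v.tail⟩ := by
  simp only [Machine.next, h]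

theorem Machine.next_of_left {T : Machine B Q} {u v : List B} {q q' : Q} {b : B}
    (h : T.tr q (v.headD T.blank) = (q', b, .left)) :
    T.next ⟨u, q, v⟩ = ⟨u.dropLast, q', u.getLastD T.blank :: b :: v.tail⟩ := by
  simp only [Machine.next, h]

/-- For each state and letter read, a step copies the tape outside a window around the head and
rewrites the window; the finitely many cases are united. -/
theorem isSynchronous_next [Finite B] [Finite Q] (T : Machine B Q) :
    IsSynchronous fun v w => ∃ c : Config B Q, v = c.word ∧ w = (T.next c).word := by
  have key : ∀ p : Q × B, IsSynchronous fun v w => ∃ c : Config B Q, c.q = p.1 ∧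
      c.v.headD T.blank = p.2 ∧ v = c.word ∧ w = (T.next c).word := by
    rintro ⟨q, y⟩
    rcases h : T.tr q y with ⟨q', b, m⟩
    have hd := fun s => isSynchronous_replace_head (Q := Q) T.blank y s
    cases m with
    | right =>
      refine (((hd (.inr q')).cons (.inr q) (.inl b)).prepend_inl fun _ => True).congr
        fun v w => ?_
      constructor
      · rintro ⟨⟨u, _, t⟩, rfl, rfl, rfl, rfl⟩
        refine ⟨u, _, _, by simp, rfl, ?_, _, _, rfl, rfl, t, rfl, rfl, rfl⟩
        replace h := Machine.next_of_right (u := u) h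
        simp [h, Config.word]
      · rintro ⟨u, _, _, -, rfl, rfl, _, _, rfl, rfl, t, ht, rfl, rfl⟩
        refine ⟨⟨u, q, t⟩, rfl, ht, rfl, ?_⟩
        simp [Machine.next_of_right (ht ▸ h), Config.word]
    | stay =>
      refine (((hd (.inl b)).cons (.inr q) (.inr q')).prepend_inl fun _ => True).congr
        fun v w => ?_
      constructor
      · rintro ⟨⟨u, _, t⟩, rfl, rfl, rfl, rfl⟩
        refine ⟨u, _, _, by simp, rfl, ?_, _, _, rfl, rfl, t, rfl, rfl, rfl⟩
        replace h := Machine.next_of_stay (u := u) h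
        simp [h, Config.word]
      · rintro ⟨u, _, _, -, rfl, rfl, _, _, rfl, rfl, t, ht, rfl, rfl⟩
        refine ⟨⟨u, q, t⟩, rfl, ht, rfl, ?_⟩
        simp [Machine.next_of_stay (ht ▸ h), Config.word]
    | left =>
      -- If a letter `x` precedes the head, then `x q y` becomes `q' x b`. At the left end a blank
      -- has to be created, and the shift moves the rest of the word by one place.
      refine (((IsSynchronous.exists fun x : B => ((hd (.inl b)).cons (.inr q) (.inl x)).cons
        (.inl x) (.inr q')).prepend_inl fun _ => True).or
        (((hd (.inl b)).comp (isSynchronous_shift (.inl T.blank))).cons (.inr q) (.inr q'))).congr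
        fun v w => ?_
      constructor
      · rintro ⟨⟨u, _, t⟩, rfl, rfl, rfl, rfl⟩
        replace h := fun u => Machine.next_of_left (u := u) h
        rcases List.eq_nil_or_concat u with rfl | ⟨u, x, rfl⟩
        · refine Or.inr ⟨_, _, rfl, ?_, _, ⟨t, rfl, rfl, rfl⟩, rfl⟩
          simp [h, Config.word]
        · refine Or.inl ⟨u, _, _, by simp, ?_, ?_, x, _, _, rfl, rfl, _, _, rfl, rfl, t, rfl, rfl,
            rfl⟩
          · simp [Config.word]
          · simp [h, Config.word]
      · rintro (⟨u, _, _, -, rfl, rfl, x, _, _, rfl, rfl, _, _, rfl, rfl, t, ht, rfl, rfl⟩ |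
          ⟨_, _, rfl, rfl, _, ⟨t, ht, rfl, rfl⟩, rfl⟩)
        · refine ⟨⟨u ++ [x], q, t⟩, rfl, ht, by simp [Config.word], ?_⟩
          simp [Machine.next_of_left (ht ▸ h), Config.word]
        · refine ⟨⟨[], q, t⟩, rfl, ht, by simp [Config.word], ?_⟩
          simp [Machine.next_of_left (ht ▸ h), Config.word]
  refine (IsSynchronous.exists key).congr fun v w => ?_
  constructor
  · rintro ⟨c, hv, hw⟩
    exact ⟨(_, _), c, rfl, rfl, hv, hw⟩
  · rintro ⟨_, c, -, -, hv, hw⟩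
    exact ⟨c, hv, hw⟩

section Order

theorem configLT_trichotomous {r : B ⊕ Q → B ⊕ Q → Prop} [IsStrictTotalOrder (B ⊕ Q) r]
    {c d : Config B Q} (h₁ : ¬ configLT r c d) (h₂ : ¬ configLT r d c) : c = d :=
  Config.word_injective ((inferInstance : Std.Trichotomous (List.Shortlex r)).trichotomous _ _
    h₁ h₂)

variable [Finite B] [Finite Q] (T : Machine B Q) (r : B ⊕ Q → B ⊕ Q → Prop)
  [IsStrictTotalOrder (B ⊕ Q) r]

/-- This expresses the successor by the order alone, in a form to which composition (for the
intermediate element) and difference (for the negation) apply. -/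
theorem Machine.succ_eq_iff {c d : Config B Q} : T.succ r c = d ↔
    configLT r c d ∧ ¬ ∃ e, configLT r c e ∧ configLT r e d := by
  have h₁ : configLT r c (T.succ r c) := (configLT_wf r).min_mem _ (exists_configLT r T.blank c)
  have h₂ : ∀ e, configLT r c e → ¬ configLT r e (T.succ r c) := fun e he =>
    (configLT_wf r).not_lt_min {d | configLT r c d} he
  constructor
  · rintro rfl
    exact ⟨h₁, fun ⟨e, he, he'⟩ => h₂ e he he'⟩
  · rintro ⟨h₃, h₄⟩
    exact configLT_trichotomous (fun h => h₄ ⟨_, h₁, h⟩) (h₂ d h₃)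

theorem isSynchronous_succ :
    IsSynchronous fun v w => ∃ c : Config B Q, v = c.word ∧ w = (T.succ r c).word := by
  have hd := isSynchronous_config_eq (B := B) (Q := Q)
  -- Composing with the diagonal on both sides restricts shortlex to words of configurations.
  have hlt := (hd.comp (isSynchronous_shortlex r)).comp hd
  refine (hlt.diff (hlt.comp hlt)).congr fun v w => ?_
  constructor
  · rintro ⟨c, rfl, rfl⟩
    obtain ⟨h₁, h₂⟩ := (T.succ_eq_iff r).1 (rfl : T.succ r c = _)
    refine ⟨⟨_, ⟨_, ⟨c, rfl, rfl⟩, h₁⟩, _, rfl, rfl⟩, ?_⟩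
    rintro ⟨_, ⟨_, ⟨_, ⟨c', h, rfl⟩, h₃⟩, e, rfl, rfl⟩, _, ⟨_, ⟨e', h', rfl⟩, h₄⟩, d, rfl, h''⟩
    obtain rfl := Config.word_injective h
    obtain rfl := Config.word_injective h'
    obtain rfl := Config.word_injective h''
    exact h₂ ⟨e, h₃, h₄⟩
  · rintro ⟨⟨_, ⟨_, ⟨c, rfl, rfl⟩, h₁⟩, d, rfl, rfl⟩, h₂⟩
    refine ⟨c, rfl, congrArg Config.word ((T.succ_eq_iff r).2 ⟨h₁, ?_⟩).symm⟩
    rintro ⟨e, h₃, h₄⟩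
    exact h₂ ⟨e.word, ⟨_, ⟨_, ⟨c, rfl, rfl⟩, h₃⟩, e, rfl, rfl⟩, _, ⟨_, ⟨e, rfl, rfl⟩, h₄⟩, d, rfl,
      rfl⟩

end Order

end Configurations

/-! ### The presentation of the algebra -/

section Presentation

variable {B Q : Type}

/-- The letters of the presentation: four tags, bits, and the letters of configurations. -/
abbrev Letter (B Q : Type) : Type := Fin 4 ⊕ Bool ⊕ B ⊕ Q

/-- `Encodes x w`: the word `w` represents the element `x`. -/
def Encodes : Carrier B Q → List (Letter B Q) → Prop
  | .zero, w => w = [.inl 0]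
  | .chain i x, w => ∃ l : List Bool,
      w = .inl 1 :: l.map (fun b => .inr (.inl b)) ∧ l.length = i ∧ bitVal l = x
  | .top c, w => w = .inl 2 :: c.word.map fun b => .inr (.inr b)
  | .bot c, w => w = .inl 3 :: c.word.map fun b => .inr (.inr b)

theorem bit_injective : Function.Injective fun b : Bool => (.inr (.inl b) : Letter B Q) :=
  Sum.inr_injective.comp Sum.inl_injective

theorem sym_injective : Function.Injective fun b : B ⊕ Q => (.inr (.inr b) : Letter B Q) :=
  Sum.inr_injective.comp Sum.inr_injective

theorem exists_encodes (x : Carrier B Q) : ∃ w, Encodes x w := by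
  match x with
  | .zero => exact ⟨_, rfl⟩
  | .chain i x =>
    obtain ⟨l, h₁, h₂⟩ := exists_bitVal i x x.2
    exact ⟨_, l, rfl, h₁, h₂⟩
  | .top c => exact ⟨_, rfl⟩
  | .bot c => exact ⟨_, rfl⟩

/-- The tag of an element. -/
def Carrier.tag : Carrier B Q → Fin 4
  | .zero => 0
  | .chain _ _ => 1
  | .top _ => 2
  | .bot _ => 3

theorem Encodes.head?_eq {x : Carrier B Q} {w : List (Letter B Q)} (hx : Encodes x w) :
    w.head? = some (.inl x.tag) := by
  match x, hx with
  | .zero, h => exact congrArg List.head? h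
  | .chain _ _, ⟨_, h, _⟩ => exact congrArg List.head? h
  | .top _, h => exact congrArg List.head? h
  | .bot _, h => exact congrArg List.head? h

theorem Encodes.unique {x y : Carrier B Q} {w : List (Letter B Q)} (hx : Encodes x w)
    (hy : Encodes y w) : x = y := by
  have h := Sum.inl_injective (Option.some_injective _ (hx.head?_eq.symm.trans hy.head?_eq))
  rcases x with _ | ⟨i, x⟩ | c | c <;> rcases y with _ | ⟨j, y⟩ | d | d <;>
    try (simp [Carrier.tag] at h; done)
  · rfl
  · obtain ⟨l, rfl, rfl, h₁⟩ := hx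
    obtain ⟨l', h', rfl, h₂⟩ := hy
    obtain rfl := List.map_injective_iff.2 bit_injective (List.cons.inj h').2
    rw [Fin.ext (h₁.symm.trans h₂)]
  all_goals
    rw [Config.word_injective (List.map_injective_iff.2 sym_injective
      (List.cons.inj (hx.symm.trans hy)).2)]

theorem IsSynchronous.tag {α β : Type*} {R : WordRel α β} (hR : IsSynchronous R)
    {f : α → Letter B Q} {g : β → Letter B Q} (hf : f.Injective) (hg : g.Injective)
    (i j : Fin 4) : IsSynchronous fun v w => ∃ v' w', v = .inl i :: v'.map f ∧
      w = .inl j :: w'.map g ∧ R v' w' := by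
  refine ((hR.map hf hg).cons (.inl i) (.inl j)).congr fun v w => ?_
  constructor
  · rintro ⟨v', w', h₁, h₂, h₃⟩
    exact ⟨_, _, h₁, h₂, v', w', rfl, rfl, h₃⟩
  · rintro ⟨_, _, h₁, h₂, v', w', rfl, rfl, h₃⟩
    exact ⟨v', w', h₁, h₂, h₃⟩

/-- The relation between words induced by a unary operation. -/
def opGraph (f : Carrier B Q → Carrier B Q) : WordRel (Letter B Q) (Letter B Q) :=
  fun v w => ∃ x, Encodes x v ∧ Encodes (f x) w

/-- The carrier has four kinds of elements, so the graph is a union of four pieces that can be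
checked independently. -/
theorem isSynchronous_opGraph {f : Carrier B Q → Carrier B Q} (hzero : f .zero = .zero)
    (hchain : IsSynchronous fun v w => ∃ i x, Encodes (.chain i x : Carrier B Q) v ∧
      Encodes (f (.chain i x)) w)
    (htop : IsSynchronous fun v w => ∃ c, Encodes (.top c : Carrier B Q) v ∧
      Encodes (f (.top c)) w)
    (hbot : IsSynchronous fun v w => ∃ c, Encodes (.bot c : Carrier B Q) v ∧
      Encodes (f (.bot c)) w) : IsSynchronous (opGraph f) := by
  have h₀ := (isSynchronous_nil (α := Bool) (β := Bool)).tag (B := B) (Q := Q) bit_injective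
    bit_injective 0 0
  refine (((h₀.or hchain).or htop).or hbot).congr fun v w => ?_
  constructor
  · rintro ⟨_ | ⟨i, x⟩ | c | c, h₁, h₂⟩
    · rw [hzero] at h₂
      exact Or.inl (Or.inl (Or.inl ⟨[], [], h₁, h₂, rfl, rfl⟩))
    · exact Or.inl (Or.inl (Or.inr ⟨i, x, h₁, h₂⟩))
    · exact Or.inl (Or.inr ⟨c, h₁, h₂⟩)
    · exact Or.inr ⟨c, h₁, h₂⟩
  · rintro (((⟨_, _, h₁, h₂, rfl, rfl⟩ | ⟨i, x, h₁, h₂⟩) | ⟨c, h₁, h₂⟩) | ⟨c, h₁, h₂⟩)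
    · exact ⟨.zero, h₁, by rwa [hzero]⟩
    all_goals exact ⟨_, h₁, h₂⟩

theorem isSynchronous_chain_id : IsSynchronous fun v w => ∃ i x,
    Encodes (.chain i x : Carrier B Q) v ∧ Encodes (.chain i x : Carrier B Q) w := by
  have h : IsSynchronous fun l l' => l.length = l'.length ∧ bitVal l = bitVal l' := by
    refine IsSynchronous.of_family (ι := Bool)
      (fun i l l' => i = true ∧ l.length = l'.length ∧ bitVal l = bitVal l')
      (fun i a b => ⟨i && a == b, fun v w => ?_⟩) (fun i a => ⟨false, by simp⟩)
      (fun i a => ⟨false, by simp⟩) true |>.congr (by simp)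
    cases a <;> cases b <;> simp [bitVal] <;> omega
  refine (h.tag bit_injective bit_injective 1 1).congr fun v w => ?_
  constructor
  · rintro ⟨i, x, ⟨l, h₁, h₂, h₃⟩, ⟨l', h₁', h₂', h₃'⟩⟩
    exact ⟨l, l', h₁, h₁', h₂.trans h₂'.symm, h₃.trans h₃'.symm⟩
  · rintro ⟨l, l', h₁, h₂, h₃, h₄⟩
    exact ⟨l.length, ⟨bitVal l, bitVal_lt l⟩, ⟨l, h₁, rfl, rfl⟩, ⟨l', h₂, h₃.symm, h₄.symm⟩⟩

/-- Relations between configurations yield relations between their encodings. -/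
theorem IsSynchronous.config_tag {f : Config B Q → Config B Q} {p : Config B Q → Prop}
    (h : IsSynchronous fun v w => ∃ c : Config B Q, p c ∧ v = c.word ∧ w = (f c).word)
    (i j : Fin 4) :
    IsSynchronous fun v w => ∃ c : Config B Q, p c ∧
      v = (.inl i : Letter B Q) :: c.word.map (fun b => .inr (.inr b)) ∧
      w = (.inl j : Letter B Q) :: (f c).word.map (fun b => .inr (.inr b)) := by
  refine (h.tag sym_injective sym_injective i j).congr fun v w => ?_
  constructor
  · rintro ⟨c, hc, h₁, h₂⟩
    exact ⟨_, _, h₁, h₂, c, hc, rfl, rfl⟩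
  · rintro ⟨_, _, h₁, h₂, c, hc, rfl, rfl⟩
    exact ⟨c, hc, h₁, h₂⟩

theorem isSynchronous_config_tag_id [Finite Q] (i j : Fin 4) :
    IsSynchronous fun v w => ∃ c : Config B Q,
      v = (.inl i : Letter B Q) :: c.word.map (fun b => .inr (.inr b)) ∧
      w = (.inl j : Letter B Q) :: c.word.map (fun b => .inr (.inr b)) :=
  (IsSynchronous.config_tag (f := id) (p := fun _ => True)
    (isSynchronous_config_eq.congr (by simp)) i j).congr (by simp)

theorem isSynchronous_opGraph_id [Finite Q] : IsSynchronous (opGraph (B := B) (Q := Q) id) :=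
  isSynchronous_opGraph rfl isSynchronous_chain_id (isSynchronous_config_tag_id 2 2)
    (isSynchronous_config_tag_id 3 3)

theorem isSynchronous_opGraph_alpha [Finite Q] :
    IsSynchronous (opGraph (B := B) (Q := Q) alpha) :=
  isSynchronous_opGraph rfl isSynchronous_chain_id (isSynchronous_config_tag_id 2 3)
    (isSynchronous_config_tag_id 3 3)

theorem isSynchronous_opGraph_beta [Finite Q] :
    IsSynchronous (opGraph (B := B) (Q := Q) beta) := by
  refine isSynchronous_opGraph rfl ?_ (isSynchronous_config_tag_id 2 2)
    (isSynchronous_config_tag_id 3 3)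
  -- Decrement within a chain, or from the minimum to zero; the word for zero is a bare tag, so its
  -- track is empty.
  refine ((isSynchronous_bitVal_succ.tag bit_injective bit_injective 1 1).or
    ((isSynchronous_bitVal_zero (β := Bool)).tag bit_injective bit_injective 1 0)).congr
    fun v w => ?_
  constructor
  · rintro ⟨i, x, ⟨l, h₁, h₂, h₃⟩, h⟩
    by_cases hx : (x : ℕ) = 0
    · rw [beta, if_pos hx] at h
      exact Or.inr ⟨l, [], h₁, h, h₃.trans hx, rfl⟩
    · rw [beta, if_neg hx] at h
      obtain ⟨l', h₁', h₂', h₃'⟩ := h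
      simp only at h₃'
      exact Or.inl ⟨l, l', h₁, h₁', by omega, by omega⟩
  · rintro (⟨l, l', h₁, h₂, h₃, h₄⟩ | ⟨l, _, h₁, h₂, h₃, rfl⟩)
    · refine ⟨l.length, ⟨bitVal l, bitVal_lt l⟩, ⟨l, h₁, rfl, rfl⟩, ?_⟩
      rw [beta, if_neg (by simp [h₄])]
      exact ⟨l', h₂, h₃.symm, by simp [h₄]⟩
    · refine ⟨l.length, ⟨bitVal l, bitVal_lt l⟩, ⟨l, h₁, rfl, rfl⟩, ?_⟩
      rw [beta, if_pos h₃]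
      exact h₂

theorem encodes_chainMax {i : ℕ} {w : List (Letter B Q)} :
    Encodes (chainMax i : Carrier B Q) w ↔ ∃ l : List Bool,
      w = .inl 1 :: l.map (fun b => .inr (.inl b)) ∧ l.length = i ∧
        bitVal l + 1 = 2 ^ l.length := by
  simp only [chainMax, Encodes]
  refine exists_congr fun l => and_congr_right fun _ => and_congr_right fun h => ?_
  have := Nat.two_pow_pos i
  rw [h]
  omega

theorem isSynchronous_opGraph_lambda [Finite Q] :
    IsSynchronous (opGraph (B := B) (Q := Q) lambda) := by
  refine isSynchronous_opGraph rfl ?_ (isSynchronous_config_tag_id 2 2)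
    (isSynchronous_config_tag_id 3 3)
  refine (((isSynchronous_length (α := Bool) 0).and isSynchronous_bitVal_max).tag bit_injective
    bit_injective 1 1).congr fun v w => ?_
  simp only [lambda, encodes_chainMax]
  constructor
  · rintro ⟨i, x, ⟨l, h₁, h₂, h₃⟩, l', h₁', h₂', h₃'⟩
    exact ⟨l, l', h₁, h₁', h₂.trans h₂'.symm, h₃'⟩
  · rintro ⟨l, l', h₁, h₂, h₃, h₄⟩
    exact ⟨l.length, ⟨bitVal l, bitVal_lt l⟩, ⟨l, h₁, rfl, rfl⟩, l', h₂, h₃.symm, h₄⟩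

theorem isSynchronous_opGraph_mu [Finite Q] :
    IsSynchronous (opGraph (B := B) (Q := Q) mu) := by
  refine isSynchronous_opGraph rfl ?_ (isSynchronous_config_tag_id 2 2)
    (isSynchronous_config_tag_id 3 3)
  refine ((isSynchronous_right_nil (α := Bool) (β := Bool)).tag bit_injective
    bit_injective 1 0).congr fun v w => ?_
  constructor
  · rintro ⟨i, x, ⟨l, h₁, h₂, h₃⟩, h⟩
    exact ⟨l, [], h₁, h, rfl⟩
  · rintro ⟨l, _, h₁, h₂, rfl⟩
    exact ⟨l.length, ⟨bitVal l, bitVal_lt l⟩, ⟨l, h₁, rfl, rfl⟩, h₂⟩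

theorem isSynchronous_opGraph_delta [Finite B] [Finite Q] (T : Machine B Q) :
    IsSynchronous (opGraph (delta T)) :=
  isSynchronous_opGraph rfl isSynchronous_chain_id (isSynchronous_config_tag_id 2 2)
    ((IsSynchronous.config_tag (f := T.next) (p := fun _ => True)
      ((isSynchronous_next T).congr (by simp)) 3 3).congr (by simp [Encodes, delta]))

theorem isSynchronous_opGraph_zeta [Finite B] [Finite Q] (T : Machine B Q)
    (r : B ⊕ Q → B ⊕ Q → Prop) [IsStrictTotalOrder (B ⊕ Q) r] :
    IsSynchronous (opGraph (zeta T r)) :=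
  isSynchronous_opGraph rfl isSynchronous_chain_id
    ((IsSynchronous.config_tag (f := T.succ r) (p := fun _ => True)
      ((isSynchronous_succ T r).congr (by simp)) 2 2).congr (by simp [Encodes, zeta]))
    (isSynchronous_config_tag_id 3 3)

/-- All exponents `k` are allowed here, so only the letters, the state and the length matter; that
the exponents are squares is enforced only by the run of `T`. -/
theorem isSynchronous_opGraph_gamma [Finite Q] (T : Machine B Q) :
    IsSynchronous (opGraph (gamma T)) := by
  refine isSynchronous_opGraph rfl isSynchronous_chain_id (isSynchronous_config_tag_id 2 2) ?_
  let p : Config B Q → Prop := fun c =>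
    c.q = T.sq ∧ c.contents = List.replicate c.contents.length T.a
  have hp : IsSynchronous fun v w => ∃ c, p c ∧ v = c.word ∧ w = c.word := by
    refine (isSynchronous_config_diag (fun b => b = T.a) (· = T.sq)).congr fun v w => ?_
    refine exists_congr fun c => ?_
    simp only [p, List.eq_replicate_iff, true_and]
    tauto
  have hn : IsSynchronous fun v w => ∃ c, ¬ p c ∧ v = c.word ∧ w = c.word := by
    refine (isSynchronous_config_eq.diff hp).congr fun v w => ?_
    constructor
    · rintro ⟨c, hc, rfl, rfl⟩
      refine ⟨⟨c, rfl, rfl⟩, ?_⟩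
      rintro ⟨d, hd, h, -⟩
      exact hc (Config.word_injective h ▸ hd)
    · rintro ⟨⟨c, rfl, rfl⟩, h⟩
      exact ⟨c, fun hc => h ⟨c, hc, rfl, rfl⟩, rfl, rfl⟩
  -- The surplus of one letter is the state symbol in the word of the configuration.
  have h₁ := (hp.comp ((isSynchronous_length (β := Bool) 1).and isSynchronous_bitVal_max)).tag
    sym_injective bit_injective 3 1
  refine (h₁.or (IsSynchronous.config_tag (f := id) hn 3 3)).congr fun v w => ?_
  have hl : ∀ c : Config B Q, c.word.length = c.contents.length + 1 := fun c => by
    simp [Config.word, Config.contents, add_assoc]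
  constructor
  · rintro ⟨c, h, h'⟩
    by_cases hc : p c
    · rw [gamma, if_pos hc] at h'
      obtain ⟨l, h₂, h₃, h₄⟩ := encodes_chainMax.1 h'
      exact Or.inl ⟨_, l, h, h₂, _, ⟨c, hc, rfl, rfl⟩, by rw [hl, h₃], h₄⟩
    · rw [gamma, if_neg hc] at h'
      exact Or.inr ⟨c, hc, h, h'⟩
  · rintro (⟨_, l, h₁, h₂, _, ⟨c, hc, rfl, rfl⟩, h₃, h₄⟩ | ⟨c, hc, h, h'⟩)
    · refine ⟨c, h₁, ?_⟩
      rw [gamma, if_pos hc, encodes_chainMax]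
      exact ⟨l, h₂, by rw [hl] at h₃; omega, h₄⟩
    · refine ⟨c, h, ?_⟩
      rw [gamma, if_neg hc]
      exact h'

theorem faPresentable_algX' [Finite B] [Finite Q] (T : Machine B Q)
    (r : B ⊕ Q → B ⊕ Q → Prop) [IsStrictTotalOrder (B ⊕ Q) r] :
    FAPresentable unLang (AlgX' T r) := by
  let K : Language (Letter B Q) := {w | ∃ x : Carrier B Q, Encodes x w}
  let φ : {w // w ∈ K} → AlgX' T r := fun w => w.2.choose
  have hφ : ∀ w : {w // w ∈ K}, Encodes (φ w) w.1 := fun w => w.2.choose_spec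
  have hφ' : ∀ w x, (∃ h : w ∈ K, φ ⟨w, h⟩ = x) ↔ Encodes x w := fun w x =>
    ⟨fun ⟨h, hx⟩ => hx ▸ hφ ⟨w, h⟩, fun h => ⟨⟨x, h⟩, (hφ ⟨w, _⟩).unique h⟩⟩
  have hgraph : ∀ (R : (Fin 2 → AlgX' T r) → Prop) (f : Carrier B Q → Carrier B Q),
      (∀ x, R x ↔ f (x 0) = x 1) → IsSynchronous (opGraph f) → IsRegularRel (Lam φ R) := by
    intro R f hR hf
    convert hf.isRegularRel using 1
    ext w
    constructor
    · rintro ⟨h, hw⟩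
      refine ⟨_, hφ ⟨w 0, h 0⟩, ?_⟩
      rw [(hR _).1 hw]
      exact hφ ⟨w 1, h 1⟩
    · rintro ⟨x, h₀, h₁⟩
      obtain ⟨k₀, rfl⟩ := (hφ' _ _).2 h₀
      obtain ⟨k₁, h₁⟩ := (hφ' _ _).2 h₁
      exact ⟨fun i => by fin_cases i; exacts [k₀, k₁], (hR _).2 h₁.symm⟩
  refine ⟨Letter B Q, inferInstance, K, φ, ?_, fun x => ?_, ?_, fun n R => R.elim, ?_⟩
  · have h := (isSynchronous_opGraph_id (B := B) (Q := Q)).isRegular_diag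
    have hK : K = {w | opGraph id w w} :=
      Set.ext fun w => exists_congr fun x => (and_self_iff).symm
    rwa [hK]
  · obtain ⟨w, hw⟩ := exists_encodes (x : Carrier B Q)
    obtain ⟨h, hx⟩ := (hφ' w x).2 hw
    exact ⟨_, hx⟩
  · exact hgraph _ id (fun x => Iff.rfl) isSynchronous_opGraph_id
  · intro n f
    cases f with
    | alpha => exact hgraph _ _ (fun x => Iff.rfl) isSynchronous_opGraph_alpha
    | beta => exact hgraph _ _ (fun x => Iff.rfl) isSynchronous_opGraph_beta
    | gamma => exact hgraph _ _ (fun x => Iff.rfl) (isSynchronous_opGraph_gamma T)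
    | delta => exact hgraph _ _ (fun x => Iff.rfl) (isSynchronous_opGraph_delta T)
    | zeta => exact hgraph _ _ (fun x => Iff.rfl) (isSynchronous_opGraph_zeta T r)
    | lambda => exact hgraph _ _ (fun x => Iff.rfl) isSynchronous_opGraph_lambda
    | mu => exact hgraph _ _ (fun x => Iff.rfl) isSynchronous_opGraph_mu

end Presentation

/-! ### Generation -/

section Generation

open FirstOrder

variable {B Q : Type}

/-- A set that is closed under `beta` and contains the maximum of a chain contains this chain and
the zero. -/
theorem chain_mem_of_beta {S : Set (Carrier B Q)} (hbeta : ∀ x ∈ S, beta x ∈ S) {i : ℕ}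
    (hi : chainMax i ∈ S) : (∀ x, .chain i x ∈ S) ∧ .zero ∈ S := by
  have h : ∀ k (hk : k < 2 ^ i), (.chain i ⟨2 ^ i - 1 - k, by omega⟩ : Carrier B Q) ∈ S := by
    intro k
    induction k with
    | zero => exact fun _ => hi
    | succ k ih =>
      intro hk
      have := hbeta _ (ih (by omega))
      rw [beta, if_neg (by simp; omega)] at this
      exact this
  have h' : ∀ x, .chain i x ∈ S := fun x => by
    have := h (2 ^ i - 1 - x) (by omega)
    have hx : 2 ^ i - 1 - (2 ^ i - 1 - (x : ℕ)) = x := by omega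
    simpa only [hx] using this
  refine ⟨h', ?_⟩
  have := hbeta _ (h' ⟨0, Nat.two_pow_pos i⟩)
  rwa [beta, if_pos rfl] at this

theorem finite_configLT [Finite B] [Finite Q] (r : B ⊕ Q → B ⊕ Q → Prop) (c : Config B Q) :
    {d | configLT r d c}.Finite := by
  have h : (Config.word '' {d | configLT r d c}).Finite := by
    refine (List.finite_length_le (B ⊕ Q) c.word.length).subset ?_
    rintro _ ⟨d, hd, rfl⟩
    rcases List.shortlex_def.1 hd with h | h
    exacts [h.le, h.1.le]
  exact h.of_finite_image Config.word_injective.injOn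

variable [Finite B] [Finite Q] (T : Machine B Q) (r : B ⊕ Q → B ⊕ Q → Prop)
  [IsStrictTotalOrder (B ⊕ Q) r]

/-- Iterates of the successor cannot jump over an element `c`. If they never hit `c`, they are
infinitely many distinct words below it, contradicting `finite_configLT`. -/
theorem exists_succ_iterate : ∃ c₀ : Config B Q, ∀ c, ∃ n, (T.succ r)^[n] c₀ = c := by
  let c₀ := (configLT_wf r).min (Set.univ : Set (Config B Q)) ⟨T.init, trivial⟩
  have hmin : ∀ c, ¬ configLT r c c₀ := fun c =>
    (configLT_wf r).not_lt_min Set.univ (Set.mem_univ c)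
  refine ⟨c₀, fun c => ?_⟩
  by_contra! hne
  have hlt : ∀ n, configLT r ((T.succ r)^[n] c₀) c := by
    intro n
    induction n with
    | zero =>
      by_contra h
      exact hne 0 (configLT_trichotomous h (hmin c))
    | succ n ih =>
      by_contra h
      refine hne (n + 1) (configLT_trichotomous h fun h' => ?_)
      rw [Function.iterate_succ_apply'] at h'
      exact ((T.succ_eq_iff r).1 rfl).2 ⟨c, ih, h'⟩
  have hstep : ∀ n, configLT r ((T.succ r)^[n] c₀) ((T.succ r)^[n + 1] c₀) := fun n => by
    rw [Function.iterate_succ_apply']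
    exact ((T.succ_eq_iff r).1 rfl).1
  -- Transitivity follows from well-foundedness, which excludes cycles of length two and three, and
  -- trichotomy.
  have : IsTrans (Config B Q) (configLT r) :=
    ⟨fun a b c h h' => by
      by_contra hn
      refine (configLT_wf r).asymmetric₃ _ _ _ h h' ?_
      by_contra hn'
      exact (configLT_wf r).asymmetric _ _ h (configLT_trichotomous hn hn' ▸ h')⟩
  have hmono : ∀ m n, m < n → configLT r ((T.succ r)^[m] c₀) ((T.succ r)^[n] c₀) := by
    intro m n hmn
    exact Nat.rel_of_forall_rel_succ_of_lt (configLT r) hstep hmn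
  have hinj : Function.Injective fun n => (T.succ r)^[n] c₀ := by
    intro m n (hmn : (T.succ r)^[m] c₀ = (T.succ r)^[n] c₀)
    by_contra hne
    rcases Nat.lt_or_gt_of_ne hne with h | h
    · exact (configLT_wf r).irrefl.irrefl _ (hmn ▸ hmono _ _ h)
    · exact (configLT_wf r).irrefl.irrefl _ (hmn ▸ hmono _ _ h)
  exact Set.infinite_of_injective_forall_mem hinj hlt (finite_configLT r c)

theorem mem_of_closedUnder {N : unLang.Substructure (AlgX' T r)} (f : unLang.Functions 1)
    {x : AlgX' T r} (hx : x ∈ N) : Language.Structure.funMap f (fun _ : Fin 1 => x) ∈ N :=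
  N.fun_mem f _ fun _ => hx

theorem fg_algX' : Language.Structure.FG unLang (AlgX' T r) := by
  obtain ⟨c₀, hc₀⟩ := exists_succ_iterate T r
  refine Language.Structure.fg_iff.2 ⟨{(Carrier.top c₀ : Carrier B Q)}, Set.finite_singleton _, ?_⟩
  rw [eq_top_iff]
  intro x _
  refine Language.Substructure.mem_closure.2 fun N hN => ?_
  have hmem := fun f (x : AlgX' T r) (hx : x ∈ N) => mem_of_closedUnder T r f hx
  have htop : ∀ c, (.top c : Carrier B Q) ∈ (N : Set (AlgX' T r)) := by
    intro c
    obtain ⟨n, rfl⟩ := hc₀ c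
    induction n with
    | zero => exact hN rfl
    | succ n ih =>
      rw [Function.iterate_succ_apply']
      exact hmem .zeta _ ih
  have hbot : ∀ c, (.bot c : Carrier B Q) ∈ (N : Set (AlgX' T r)) :=
    fun c => hmem .alpha _ (htop c)
  have hmax : ∀ i, (chainMax i : Carrier B Q) ∈ (N : Set (AlgX' T r)) := by
    intro i
    have h := hmem .gamma _ (hbot ⟨List.replicate i T.a, T.sq, []⟩)
    change gamma T _ ∈ (N : Set (AlgX' T r)) at h
    rw [gamma, if_pos (by simp [Config.contents])] at h
    simpa [Config.contents] using h
  have hchain := fun i => chain_mem_of_beta (S := (N : Set (AlgX' T r))) (hmem .beta) (hmax i)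
  match x with
  | .zero => exact (hchain 0).2
  | .chain i x => exact (hchain i).1 x
  | .top c => exact htop c
  | .bot c => exact hbot c

end Generation

/-! ### The subalgebra generated by the initial configuration -/

section Subalgebra

open FirstOrder

variable {B Q : Type} {T : Machine B Q}

/-- Only `β`, `γ` and `δ` are needed to generate `Y`, and both signatures contain them. -/
theorem setY_subset (hT : T.GeneratesSquares) {S : Set (Carrier B Q)} (h₀ : g₀ T ∈ S)
    (hbeta : ∀ x ∈ S, beta x ∈ S) (hgamma : ∀ x ∈ S, gamma T x ∈ S)
    (hdelta : ∀ x ∈ S, delta T x ∈ S) : setY T ⊆ S := by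
  have hrun : ∀ n, .bot (T.run n) ∈ S := by
    intro n
    induction n with
    | zero => exact h₀
    | succ n ih =>
      rw [Machine.run, Function.iterate_succ_apply']
      exact hdelta _ ih
  obtain ⟨t, -, ht⟩ := hT.1
  have hmax : ∀ j, 1 ≤ j → chainMax (j ^ 2) ∈ S := by
    intro j hj
    obtain ⟨h₁, h₂⟩ := ht (j - 1)
    rw [Nat.sub_add_cancel hj] at h₂
    have h := hgamma _ (hrun (t (j - 1)))
    rw [gamma, if_pos ⟨h₁, by rw [h₂, List.length_replicate]⟩, h₂, List.length_replicate] at h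
    exact h
  have hchain := fun j hj => chain_mem_of_beta hbeta (hmax j hj)
  rintro _ ((rfl | ⟨n, rfl⟩) | ⟨j, hj, x, rfl⟩)
  · exact (hchain 1 le_rfl).2
  · exact hrun n
  · exact (hchain j hj).1 x

theorem zero_mem_setY : .zero ∈ setY T := Or.inl (Or.inl rfl)

theorem run_mem_setY (n : ℕ) : .bot (T.run n) ∈ setY T := Or.inl (Or.inr ⟨n, rfl⟩)

theorem chain_mem_setY {j : ℕ} (hj : 1 ≤ j) (x : Fin (2 ^ (j ^ 2))) :
    .chain (j ^ 2) x ∈ setY T :=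
  Or.inr ⟨j, hj, x, rfl⟩

/-- This is where chains of non-square index are kept out: along the run, the state `sq` forces
square tape contents. -/
theorem gamma_run (hT : T.GeneratesSquares) (n : ℕ) : gamma T (.bot (T.run n)) ∈ setY T := by
  rw [gamma]
  split_ifs with h
  · obtain ⟨j, hj, h'⟩ := (hT.2 n).1 h.1
    rw [h', List.length_replicate]
    exact chain_mem_setY hj _
  · exact run_mem_setY n

theorem unary_mem_setY (hT : T.GeneratesSquares) {x : Carrier B Q} (hx : x ∈ setY T) :
    alpha x ∈ setY T ∧ beta x ∈ setY T ∧ gamma T x ∈ setY T ∧ delta T x ∈ setY T ∧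
      lambda x ∈ setY T ∧ mu x ∈ setY T := by
  rcases hx with (rfl | ⟨n, rfl⟩) | ⟨j, hj, x, rfl⟩
  · exact ⟨zero_mem_setY, zero_mem_setY, zero_mem_setY, zero_mem_setY, zero_mem_setY,
      zero_mem_setY⟩
  · refine ⟨run_mem_setY n, run_mem_setY n, gamma_run hT n, ?_, run_mem_setY n, run_mem_setY n⟩
    have := run_mem_setY (T := T) (n + 1)
    rw [Machine.run, Function.iterate_succ_apply'] at this
    exact this
  · refine ⟨chain_mem_setY hj _, ?_, chain_mem_setY hj _, chain_mem_setY hj _,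
      chain_mem_setY hj _, zero_mem_setY⟩
    rw [beta]
    split_ifs
    exacts [zero_mem_setY, chain_mem_setY hj _]

theorem circ_mem_setY {x y : Carrier B Q} (hx : x ∈ setY T) (hy : y ∈ setY T) :
    circ x y ∈ setY T := by
  rcases hx with (rfl | ⟨n, rfl⟩) | ⟨j, hj, x, rfl⟩
  · rcases hy with (rfl | ⟨n, rfl⟩) | ⟨k, hk, y, rfl⟩
    exacts [zero_mem_setY, run_mem_setY n, zero_mem_setY]
  · rw [circ]
    exact run_mem_setY n
  · rcases hy with (rfl | ⟨n, rfl⟩) | ⟨k, hk, y, rfl⟩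
    · exact zero_mem_setY
    · exact run_mem_setY n
    · rw [circ]
      split_ifs
      exacts [chain_mem_setY hj x, chain_mem_setY hk y, zero_mem_setY]

variable [Finite B] [Finite Q] (r : B ⊕ Q → B ⊕ Q → Prop) [IsStrictTotalOrder (B ⊕ Q) r]

theorem zeta_mem_setY {x : Carrier B Q} (hx : x ∈ setY T) : zeta T r x ∈ setY T := by
  rcases hx with (rfl | ⟨n, rfl⟩) | ⟨j, hj, x, rfl⟩
  exacts [zero_mem_setY, run_mem_setY n, chain_mem_setY hj x]

theorem coe_subY (hT : T.GeneratesSquares) : (subY T r : Set (AlgX T r)) = setY T := by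
  refine Set.Subset.antisymm ?_
    (setY_subset (S := (subY T r : Set (AlgX T r))) hT ?_ ?_ ?_ ?_)
  · let N : binLang.Substructure (AlgX T r) := ⟨setY T, fun {n} f x hx => by
      cases f with
      | circ => exact circ_mem_setY (hx 0) (hx 1)
      | alpha => exact (unary_mem_setY hT (hx 0)).1
      | beta => exact (unary_mem_setY hT (hx 0)).2.1
      | gamma => exact (unary_mem_setY hT (hx 0)).2.2.1
      | delta => exact (unary_mem_setY hT (hx 0)).2.2.2.1
      | zeta => exact zeta_mem_setY r (hx 0)⟩
    have h : subY T r ≤ N :=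
      Language.Substructure.closure_le.2 (Set.singleton_subset_iff.2 (run_mem_setY 0))
    exact h
  · exact Language.Substructure.subset_closure (L := binLang) (M := AlgX T r) rfl
  · exact fun x hx => (subY T r).fun_mem BinFn.beta (fun _ => x) fun _ => hx
  · exact fun x hx => (subY T r).fun_mem BinFn.gamma (fun _ => x) fun _ => hx
  · exact fun x hx => (subY T r).fun_mem BinFn.delta (fun _ => x) fun _ => hx

theorem coe_subY' (hT : T.GeneratesSquares) : (subY' T r : Set (AlgX' T r)) = setY T := by
  refine Set.Subset.antisymm ?_
    (setY_subset (S := (subY' T r : Set (AlgX' T r))) hT ?_ ?_ ?_ ?_)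
  · let N : unLang.Substructure (AlgX' T r) := ⟨setY T, fun {n} f x hx => by
      cases f with
      | alpha => exact (unary_mem_setY hT (hx 0)).1
      | beta => exact (unary_mem_setY hT (hx 0)).2.1
      | gamma => exact (unary_mem_setY hT (hx 0)).2.2.1
      | delta => exact (unary_mem_setY hT (hx 0)).2.2.2.1
      | zeta => exact zeta_mem_setY r (hx 0)
      | lambda => exact (unary_mem_setY hT (hx 0)).2.2.2.2.1
      | mu => exact (unary_mem_setY hT (hx 0)).2.2.2.2.2⟩
    have h : subY' T r ≤ N :=
      Language.Substructure.closure_le.2 (Set.singleton_subset_iff.2 (run_mem_setY 0))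
    exact h
  · exact Language.Substructure.subset_closure (L := unLang) (M := AlgX' T r) rfl
  · exact fun x hx => (subY' T r).fun_mem UnFn.beta (fun _ => x) fun _ => hx
  · exact fun x hx => (subY' T r).fun_mem UnFn.gamma (fun _ => x) fun _ => hx
  · exact fun x hx => (subY' T r).fun_mem UnFn.delta (fun _ => x) fun _ => hx

end Subalgebra

/-! ### Growth of definable fibres -/

section Growth

variable {α β : Type*}

/-- Once `w` is used up, what may follow `u` depends only on the member of `F` that has been
reached. -/
theorem exists_residual_tail {F : Set (WordRel α β)} (hF : ∀ S ∈ F, ∀ x y, residual x y S ∈ F)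
    (w : List β) : ∀ (u : List α), u.length = w.length → ∀ R ∈ F,
      ∃ S ∈ F, ∀ z, R (u ++ z) w ↔ S z [] := by
  induction w with
  | nil =>
    intro u hu R hR
    obtain rfl := List.length_eq_zero_iff.1 hu
    exact ⟨R, hR, fun z => Iff.rfl⟩
  | cons b w ih =>
    intro u hu R hR
    cases u with
    | nil => simp at hu
    | cons a u =>
      obtain ⟨S, hS, h⟩ := ih u (by simpa using hu) _ (hF R hR (some a) (some b))
      refine ⟨S, hS, fun z => ?_⟩
      rw [← h]
      simp [residual]

/-- The words on the left of a fixed word `w` have, beyond the length of `w`, only finitely many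
tails, provided that there are finitely many of them. -/
theorem IsSynchronous.exists_finite_tails {R : WordRel α β} (hR : IsSynchronous R) :
    ∃ Z : Set (List α), Z.Finite ∧ ∀ w, {v | R v w}.Finite → ∀ v, R v w →
      ∃ u z, u.length ≤ w.length ∧ z ∈ Z ∧ v = u ++ z := by
  obtain ⟨F, hF, hRF, hFc⟩ := hR
  refine ⟨insert [] (⋃ S ∈ {S ∈ F | {z | S z []}.Finite}, {z | S z []}),
    ((hF.subset (Set.sep_subset _ _)).biUnion fun S hS => hS.2).insert _, fun w hw v hv => ?_⟩
  rcases le_or_gt v.length w.length with h | h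
  · exact ⟨v, [], h, Or.inl rfl, by simp⟩
  · have hl : (v.take w.length).length = w.length := by simp [h.le]
    obtain ⟨S, hS, hSz⟩ := exists_residual_tail hFc w _ hl R hRF
    refine ⟨_, v.drop w.length, hl.le, Or.inr ?_, (List.take_append_drop _ _).symm⟩
    refine Set.mem_biUnion (x := S) ⟨hS, ?_⟩ ((hSz _).1 (by simpa using hv))
    refine Set.Finite.of_finite_image (f := fun z => v.take w.length ++ z) (hw.subset ?_)
      (List.append_right_injective _).injOn
    rintro _ ⟨z, hz, rfl⟩
    exact (hSz z).2 hz

theorem ncard_length_le (A : Type*) [Finite A] (n : ℕ) :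
    {u : List A | u.length ≤ n}.ncard ≤ (Nat.card A + 1) ^ n := by
  have h : Set.InjOn (fun (u : List A) (j : Fin n) => u[(j : ℕ)]?) {u | u.length ≤ n} := by
    intro u (hu : u.length ≤ n) v (hv : v.length ≤ n) huv
    refine List.ext_getElem? fun j => ?_
    by_cases hj : j < n
    · exact congrFun huv ⟨j, hj⟩
    · rw [List.getElem?_eq_none (by omega), List.getElem?_eq_none (by omega)]
  have := Set.ncard_le_ncard_of_injOn (t := Set.univ) _ (fun _ _ => Set.mem_univ _) h
  refine this.trans ?_
  rw [Set.ncard_univ, Nat.card_fun, Finite.card_option, Nat.card_fin]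

/-- If `X` is an infinite set of elements represented by a regular language and the graph of `g`
is regular, then some sequence of elements of `X` has fibres of at most exponential size. -/
theorem exists_fibre_growth {A : Type} [Finite A] {M : Type*} {K : Language A}
    {φ : {w // w ∈ K} → M} (hφ : Function.Surjective φ)
    (heq : IsSynchronous fun v w => ∃ hv hw, φ ⟨v, hv⟩ = φ ⟨w, hw⟩) {g : M → M}
    (hg : IsSynchronous fun v w => ∃ hv hw, g (φ ⟨v, hv⟩) = φ ⟨w, hw⟩) {X : Set M}
    (hX : IsSynchronous fun v w => v = w ∧ ∃ hv, φ ⟨v, hv⟩ ∈ X) (hinf : X.Infinite)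
    (hfib : ∀ x ∈ X, (g ⁻¹' {x}).Finite) :
    ∃ (x : ℕ → M) (k : ℕ), x.Injective ∧
      ∀ i, x i ∈ X ∧ (g ⁻¹' {x i}).ncard ≤ 2 ^ (k * (i + 1)) := by
  let r : A → A → Prop := WellOrderingRel
  let E : WordRel A A := fun v w => ∃ hv hw, φ ⟨v, hv⟩ = φ ⟨w, hw⟩
  have hwf : WellFounded (List.Shortlex r) := List.Shortlex.wf IsWellFounded.wf
  -- the least representatives
  let least : List A → Prop := fun w => w ∈ K ∧ ¬ ∃ v, List.Shortlex r v w ∧ E v w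
  have hleast : IsSynchronous fun v w => v = w ∧ least w := by
    -- Composition with the full relation forgets the left word, leaving the condition that `w` has
    -- a smaller equivalent word.
    refine ((heq.and isSynchronous_eq).diff (isSynchronous_top.comp
      ((isSynchronous_shortlex r).and heq))).congr fun v w => ?_
    constructor
    · rintro ⟨rfl, hK, h⟩
      exact ⟨⟨⟨hK, hK, rfl⟩, rfl⟩, fun ⟨u, _, hu⟩ => h ⟨u, hu⟩⟩
    · rintro ⟨⟨⟨hK, -, -⟩, rfl⟩, h⟩
      exact ⟨rfl, hK, fun ⟨u, hu⟩ => h ⟨u, trivial, hu⟩⟩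
  have hex : ∀ m, ∃ w, least w ∧ ∃ hw, φ ⟨w, hw⟩ = m := by
    intro m
    let P : Set (List A) := {w | ∃ hw, φ ⟨w, hw⟩ = m}
    have hP : P.Nonempty := by
      obtain ⟨⟨w, hw⟩, rfl⟩ := hφ m
      exact ⟨w, hw, rfl⟩
    obtain ⟨hK, hm⟩ := hwf.min_mem P hP
    refine ⟨hwf.min P hP, ⟨hK, ?_⟩, hK, hm⟩
    rintro ⟨v, hv, hv', hK', h⟩
    exact hwf.not_lt_min P ⟨hv', h.trans hm⟩ hv
  have hinj : ∀ v w, least v → least w → E v w → v = w := by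
    intro v w hv hw ⟨h₁, h₂, h₃⟩
    exact (inferInstance : Std.Trichotomous (List.Shortlex r)).trichotomous _ _
      (fun h => hw.2 ⟨v, h, h₁, h₂, h₃⟩) (fun h => hv.2 ⟨w, h, h₂, h₁, h₃.symm⟩)
  -- pumping
  have hreg := (hleast.and hX).isRegular_diag
  set L : Language A := {w | (w = w ∧ least w) ∧ w = w ∧ ∃ hw, φ ⟨w, hw⟩ ∈ X}
  have hLinf : (L : Set (List A)).Infinite := by
    intro hfin
    classical
    refine hinf ((hfin.image fun w =>
      if h : w ∈ K then φ ⟨w, h⟩ else hinf.nonempty.some).subset ?_)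
    intro m hm
    obtain ⟨w, hw, hK, rfl⟩ := hex m
    exact ⟨w, ⟨⟨rfl, hw⟩, rfl, hK, hm⟩, by simp [hK]⟩
  obtain ⟨σ, _, D, hD⟩ := hreg
  obtain ⟨w, hw, hwlen⟩ : ∃ w ∈ L, Fintype.card σ ≤ w.length := by
    by_contra! h
    exact hLinf ((List.finite_length_lt A (Fintype.card σ)).subset h)
  obtain ⟨a, b, c, -, -, hb, habc⟩ := D.pumping_lemma (hD ▸ hw) hwlen
  let p : ℕ → List A := fun i => a ++ (List.replicate i b).flatten ++ c
  have hp : ∀ i, p i ∈ L := by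
    intro i
    rw [← hD]
    refine habc (Language.mem_mul.2 ⟨_, Language.mem_mul.2 ⟨a, rfl, _, ?_, rfl⟩, c, rfl, rfl⟩)
    rw [Language.mem_kstar]
    exact ⟨List.replicate i b, rfl, fun y hy => List.eq_of_mem_replicate hy⟩
  have hlen : ∀ i, (p i).length = a.length + i * b.length + c.length := fun i => by
    simp [p, add_assoc]
  have hpinj : Function.Injective p := by
    intro i j hij
    have h := congrArg List.length hij
    rw [hlen, hlen] at h
    have hb' := List.length_pos_iff.2 hb
    exact Nat.eq_of_mul_eq_mul_right hb' (by omega)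
  have hpK : ∀ i, p i ∈ K := fun i => (hp i).1.2.1
  -- fibres
  let G : WordRel A A := fun v w => ∃ u, (v = u ∧ least u) ∧ ∃ hv hw, g (φ ⟨u, hv⟩) = φ ⟨w, hw⟩
  obtain ⟨Z, hZ, hZt⟩ := IsSynchronous.exists_finite_tails (R := G) (hleast.comp hg)
  let l := a.length + b.length + c.length
  -- The fibre has at most `(|A| + 1) ^ |p i| * |Z|` elements, with `|p i| ≤ l * (i + 1)`; `n < 2 ^
  -- n` turns both factors into powers of two.
  refine ⟨fun i => φ ⟨p i, hpK i⟩, Z.ncard + (Nat.card A + 1) * l, ?_, fun i => ⟨?_, ?_⟩⟩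
  · intro i j hij
    exact hpinj (hinj _ _ (hp i).1.2 (hp j).1.2 ⟨_, _, hij⟩)
  · obtain ⟨-, -, h, hx⟩ := hp i
    exact hx
  · have hxi : φ ⟨p i, hpK i⟩ ∈ X := (hp i).2.2.2
    let V : Set (List A) := {v | G v (p i)}
    have hVl : ∀ v ∈ V, least v := by
      rintro v ⟨_, ⟨rfl, h⟩, -⟩
      exact h
    have hVfin : V.Finite := by
      classical
      refine Set.Finite.of_finite_image
        (f := fun v => if h : v ∈ K then φ ⟨v, h⟩ else φ ⟨p i, hpK i⟩)
        ((hfib _ hxi).subset ?_) ?_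
      · rintro _ ⟨v, ⟨_, ⟨rfl, h⟩, h₁, h₂, h₃⟩, rfl⟩
        simpa [h₁] using h₃
      · intro v hv v' hv' h
        have h₁ := hVl v hv
        have h₂ := hVl v' hv'
        simp only [h₁.1, h₂.1, dite_true] at h
        exact hinj _ _ h₁ h₂ ⟨_, _, h⟩
    have h₁ : (g ⁻¹' {φ ⟨p i, hpK i⟩}).ncard ≤ V.ncard := by
      choose s hs hsK hsφ using hex
      refine Set.ncard_le_ncard_of_injOn s ?_ ?_ hVfin
      · intro m hm
        refine ⟨s m, ⟨rfl, hs m⟩, hsK m, hpK i, ?_⟩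
        rw [hsφ]
        exact hm
      · intro m _ m' _ h
        rw [← hsφ m, ← hsφ m']
        congr 2
    have h₂ : V.ncard ≤ {u : List A | u.length ≤ (p i).length}.ncard * Z.ncard := by
      rw [← Set.ncard_prod]
      refine (Set.ncard_le_ncard ?_ (((List.finite_length_le A _).prod hZ).image
        fun q => q.1 ++ q.2)).trans (Set.ncard_image_le ((List.finite_length_le A _).prod hZ))
      intro v hv
      obtain ⟨u, z, hu, hz, rfl⟩ := hZt _ hVfin v hv
      exact ⟨(u, z), ⟨hu, hz⟩, rfl⟩
    have h₃ : (p i).length ≤ l * (i + 1) := by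
      rw [hlen]
      simp only [l]
      nlinarith [Nat.zero_le (i * a.length), Nat.zero_le (i * c.length)]
    calc _ ≤ _ := h₁.trans h₂
      _ ≤ (Nat.card A + 1) ^ (p i).length * Z.ncard :=
        Nat.mul_le_mul_right _ (ncard_length_le _ _)
      _ ≤ (2 ^ (Nat.card A + 1)) ^ (l * (i + 1)) * 2 ^ Z.ncard := by
        refine Nat.mul_le_mul ?_ Nat.lt_two_pow_self.le
        exact (Nat.pow_le_pow_left Nat.lt_two_pow_self.le _).trans
          (Nat.pow_le_pow_right (by positivity) h₃)
      _ ≤ 2 ^ ((Z.ncard + (Nat.card A + 1) * l) * (i + 1)) := by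
        rw [← pow_mul, ← pow_add]
        refine Nat.pow_le_pow_right two_pos ?_
        nlinarith [Nat.zero_le (Z.ncard * i)]

end Growth

/-! ### The subalgebra has no presentation -/

section NotPresentable

open FirstOrder

theorem IsFAPresentation.isSynchronous_eq {L : FirstOrder.Language} {M : Type*} [L.Structure M]
    {A : Type*} {K : Language A} {φ : {w : List A // w ∈ K} → M} (h : IsFAPresentation L M K φ) :
    IsSynchronous fun v w => ∃ hv hw, φ ⟨v, hv⟩ = φ ⟨w, hw⟩ := by
  refine (isSynchronous_of_isRegularRel h.eq_regular).congr fun v w => ?_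
  constructor
  · rintro ⟨hv, hw, e⟩
    exact ⟨fun i => by fin_cases i; exacts [hv, hw], e⟩
  · rintro ⟨hK, e⟩
    exact ⟨hK 0, hK 1, e⟩

theorem IsFAPresentation.isSynchronous_funMap {L : FirstOrder.Language} {M : Type*}
    [L.Structure M] {A : Type*} {K : Language A} {φ : {w : List A // w ∈ K} → M}
    (h : IsFAPresentation L M K φ) (f : L.Functions 1) :
    IsSynchronous fun v w => ∃ hv hw,
      Language.Structure.funMap f (fun _ : Fin 1 => φ ⟨v, hv⟩) = φ ⟨w, hw⟩ := by
  refine (isSynchronous_of_isRegularRel (h.fun_regular 1 f)).congr fun v w => ?_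
  have key : ∀ hK : ∀ i, (![v, w] : Fin 2 → List A) i ∈ K,
      (Fin.init fun i : Fin (1 + 1) => φ ⟨(![v, w] : Fin 2 → List A) i, hK i⟩) =
        fun _ : Fin 1 => φ ⟨v, hK 0⟩ := fun hK => by
    funext i
    rw [Subsingleton.elim i 0]
    rfl
  constructor
  · rintro ⟨hv, hw, e⟩
    have hK : ∀ i, (![v, w] : Fin 2 → List A) i ∈ K := fun i => by fin_cases i; exacts [hv, hw]
    exact ⟨hK, (congrArg (Language.Structure.funMap f) (key hK)).trans e⟩
  · rintro ⟨hK, e⟩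
    exact ⟨hK 0, hK 1, (congrArg (Language.Structure.funMap f) (key hK)).symm.trans e⟩

variable {B Q : Type} {T : Machine B Q}

/-- `λ` also fixes zero and the configurations, but so does `μ`; the two together single out the
maxima of chains without using the meet. -/
theorem exists_eq_chainMax {y : Carrier B Q} (hy : y ∈ setY T) (h₁ : lambda y = y)
    (h₂ : mu y ≠ y) : ∃ j, 1 ≤ j ∧ y = chainMax (j ^ 2) := by
  rcases hy with (rfl | ⟨n, rfl⟩) | ⟨j, hj, x, rfl⟩
  · exact absurd rfl h₂
  · exact absurd rfl h₂
  · exact ⟨j, hj, h₁.symm⟩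

theorem lambda_eq_chainMax_iff {x : Carrier B Q} {i : ℕ} :
    lambda x = chainMax i ↔ ∃ y, x = .chain i y := by
  constructor
  · intro h
    rcases x with _ | ⟨j, x⟩ | c | c
    · cases h
    · simp only [lambda, chainMax, Carrier.chain.injEq] at h
      obtain ⟨rfl, -⟩ := h
      exact ⟨x, rfl⟩
    · cases h
    · cases h
  · rintro ⟨y, rfl⟩
    rfl

theorem chainMax_injective : Function.Injective (chainMax : ℕ → Carrier B Q) := by
  intro i j h
  simp only [chainMax, Carrier.chain.injEq] at h
  exact h.1

variable [Finite B] [Finite Q] (r : B ⊕ Q → B ⊕ Q → Prop) [IsStrictTotalOrder (B ⊕ Q) r]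

theorem not_faPresentable_subY' (hT : T.GeneratesSquares) :
    ¬ FAPresentable unLang (subY' T r) := by
  rintro ⟨A, _, K, φ, hφ⟩
  have hmem : ∀ x : AlgX' T r, x ∈ subY' T r ↔ x ∈ setY T := fun x => by
    rw [← coe_subY' r hT]
    rfl
  let lam : subY' T r → subY' T r := fun x => 
    Language.Structure.funMap (L := unLang) UnFn.lambda fun _ : Fin 1 => x
  let nu : subY' T r → subY' T r := fun x => 
    Language.Structure.funMap (L := unLang) UnFn.mu fun _ : Fin 1 => x
  let X : Set (subY' T r) := {x | lam x = x ∧ nu x ≠ x}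
  have hX : IsSynchronous fun v w => v = w ∧ ∃ hv, φ ⟨v, hv⟩ ∈ X := by
    refine ((isSynchronous_eq.and (hφ.isSynchronous_funMap .lambda)).diff
      (hφ.isSynchronous_funMap .mu)).congr fun v w => ?_
    constructor
    · rintro ⟨rfl, hv, h₁, h₂⟩
      exact ⟨⟨rfl, hv, hv, h₁⟩, fun ⟨_, _, h⟩ => h₂ h⟩
    · rintro ⟨⟨rfl, hv, _, h₁⟩, h₂⟩
      exact ⟨rfl, hv, h₁, fun h => h₂ ⟨hv, hv, h⟩⟩
  have hXmax : ∀ x ∈ X, ∃ j, 1 ≤ j ∧ (x.1 : Carrier B Q) = chainMax (j ^ 2) := fun x hx =>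
    exists_eq_chainMax ((hmem _).1 x.2) (congrArg Subtype.val hx.1)
      fun h => hx.2 (Subtype.ext h)
  have hfib : ∀ x : subY' T r, ∀ j, 1 ≤ j → (x.1 : Carrier B Q) = chainMax (j ^ 2) →
      (Subtype.val '' (lam ⁻¹' {x}) : Set (Carrier B Q)) = Set.range (Carrier.chain (j ^ 2)) := by
    intro x j hj hx
    ext y
    constructor
    · rintro ⟨y, rfl : lam y = x, rfl⟩
      obtain ⟨z, hz⟩ := lambda_eq_chainMax_iff.1 hx
      exact ⟨z, hz.symm⟩
    · rintro ⟨z, rfl⟩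
      exact ⟨⟨_, (hmem _).2 (chain_mem_setY hj z)⟩, Subtype.ext hx.symm, rfl⟩
  have hinf : X.Infinite := by
    refine Set.infinite_of_injective_forall_mem (f := fun j : ℕ =>
      (⟨_, (hmem _).2 (chain_mem_setY j.succ_pos ⟨2 ^ ((j + 1) ^ 2) - 1,
        Nat.sub_lt (Nat.two_pow_pos _) Nat.one_pos⟩)⟩ : subY' T r)) ?_
      fun j => ⟨Subtype.ext rfl, ?_⟩
    · intro i j h
      have := chainMax_injective (B := B) (Q := Q) (congrArg Subtype.val h)
      exact Nat.succ_injective (Nat.pow_left_injective two_ne_zero this)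
    · intro h
      cases (congrArg Subtype.val h : _)
  obtain ⟨x, k, hxinj, hx⟩ := exists_fibre_growth hφ.surjective hφ.isSynchronous_eq
    (g := lam) (hφ.isSynchronous_funMap .lambda) hX hinf (fun x hx => by
      obtain ⟨j, hj, h⟩ := hXmax x hx
      refine Set.Finite.of_finite_image (f := Subtype.val) ?_ Subtype.val_injective.injOn
      exact (Set.finite_range _).subset (hfib x j hj h).subset)
  choose j hj hxj using fun i => hXmax _ (hx i).1
  have hjinj : Function.Injective j := fun i i' h =>
    hxinj (Subtype.ext ((hxj i).trans ((congrArg (fun j => chainMax (j ^ 2)) h).trans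
      (hxj i').symm)))
  have hcard : ∀ i, 2 ^ (j i ^ 2) ≤ 2 ^ (k * (i + 1)) := by
    intro i
    refine le_trans (le_of_eq ?_) (hx i).2
    rw [← Set.ncard_image_of_injective _ Subtype.val_injective]
    refine Eq.trans ?_ (congrArg Set.ncard (hfib _ _ (hj i) (hxj i))).symm
    rw [← Set.image_univ, Set.ncard_image_of_injective, Set.ncard_univ, Nat.card_fin]
    intro a b h
    simpa using h
  -- Pigeonhole: the `k + 2` distinct values `j 0, …, j (k + 1)` cannot all be at most `k`.
  obtain ⟨i, hi, hij⟩ : ∃ i ≤ k + 1, k + 1 ≤ j i := by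
    by_contra! h
    obtain ⟨a, -, b, -, hne, hab⟩ := Finset.exists_ne_map_eq_of_card_lt_of_maps_to
      (s := Finset.range (k + 2)) (t := Finset.range (k + 1)) (f := j) (by simp)
      (fun a ha => by
        simp only [Finset.coe_range, Set.mem_Iio] at ha ⊢
        exact h a (by omega))
    exact hne (hjinj hab)
  have h := (Nat.pow_le_pow_iff_right (by norm_num)).1 (hcard i)
  -- The contradiction is `(k + 1)² ≤ j i ^ 2 ≤ k (i + 1) ≤ k (k + 2) < (k + 1)²`.
  nlinarith

end NotPresentable

/-! ### A machine that generates squares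

The head position stores the root: with `a ^ (n ^ 2)` on the tape, the head is on the `n`-th letter.
The machine marks the letters from there to the left one by one, with `e` for the first mark and
`b` for the others, and appends two letters `a` for each mark. When it finds a blank on the left,
it replaces it by `a` and removes the marks, from left to right, up to the letter `e`. -/

section SquareMachine

inductive SqLetter
  | blank
  | a
  | b
  | e

inductive SqState
  | start
  | square
  | toRight
  | append
  | toMark
  | findLetter
  | unmark

open SqLetter SqState List

instance : Finite SqLetter :=
  Finite.of_surjective (α := Fin 4) ![blank, a, b, e] fun x => by
    cases x
    exacts [⟨0, rfl⟩, ⟨1, rfl⟩, ⟨2, rfl⟩, ⟨3, rfl⟩]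

instance : Finite SqState :=
  Finite.of_surjective (α := Fin 7)
    ![start, square, toRight, append, toMark, findLetter, unmark] fun x => by
    cases x
    exacts [⟨0, rfl⟩, ⟨1, rfl⟩, ⟨2, rfl⟩, ⟨3, rfl⟩, ⟨4, rfl⟩, ⟨5, rfl⟩, ⟨6, rfl⟩]

def sqStep : SqState → SqLetter → SqState × SqLetter × Move
  | start, _ => (square, a, .stay)
  | square, _ => (toRight, e, .right)
  | toRight, blank => (append, a, .right)
  | toRight, x => (toRight, x, .right)
  | append, _ => (toMark, a, .left)
  | toMark, e => (findLetter, e, .left)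
  | toMark, x => (toMark, x, .left)
  | findLetter, a => (toRight, b, .right)
  | findLetter, blank => (unmark, a, .right)
  | findLetter, x => (findLetter, x, .left)
  | unmark, e => (square, a, .stay)
  | unmark, _ => (unmark, a, .right)

def sqMachine : Machine SqLetter SqState where
  blank := blank
  a := a
  a_ne_blank := by simp
  start := start
  sq := square
  tr := sqStep

/-- The computation leads from `c` to `d`, and before `d` it does not visit the state `square` and
the letter `e` is on the tape. -/
def Reach (c d : Config SqLetter SqState) : Prop :=
  ∃ k, sqMachine.next^[k] c = d ∧ ∀ i < k, (sqMachine.next^[i] c).q ≠ square ∧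
    e ∈ (sqMachine.next^[i] c).contents

theorem Reach.refl (c : Config SqLetter SqState) : Reach c c := ⟨0, rfl, by simp⟩

theorem Reach.head {c d : Config SqLetter SqState} (hq : c.q ≠ square) (he : e ∈ c.contents)
    (h : Reach (sqMachine.next c) d) : Reach c d := by
  obtain ⟨k, hk, hb⟩ := h
  refine ⟨k + 1, hk, fun i hi => ?_⟩
  cases i with
  | zero => exact ⟨hq, he⟩
  | succ i => exact hb i (by omega)

theorem reach_toRight {d : Config SqLetter SqState} (v : List SqLetter) :
    ∀ u, e ∈ u ++ v → blank ∉ v → Reach ⟨u ++ v, toRight, []⟩ d → Reach ⟨u, toRight, v⟩ d := by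
  induction v with
  | nil =>
    intro u _ _ h
    simpa using h
  | cons x v ih =>
    intro u he hv h
    refine Reach.head (by simp) he ?_
    have hx : sqStep toRight x = (toRight, x, .right) := by
      cases x <;> simp [sqStep] at hv ⊢
    rw [Machine.next_of_right (T := sqMachine) (v := x :: v) hx]
    exact ih _ (by simpa using he) (fun h => hv (by simp [h])) (by simpa using h)

/-- The configuration after a move to the left. -/
def movedLeft (u : List SqLetter) (q : SqState) (v : List SqLetter) :
    Config SqLetter SqState :=
  ⟨u.dropLast, q, u.getLastD blank :: v⟩

@[simp]
theorem movedLeft_concat (u v : List SqLetter) (x : SqLetter) (q : SqState) :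
    movedLeft (u ++ [x]) q v = ⟨u, q, x :: v⟩ := by
  simp [movedLeft]

theorem next_of_left {u v : List SqLetter} {x y : SqLetter} {q q' : SqState}
    (h : sqStep q x = (q', y, .left)) :
    sqMachine.next ⟨u, q, x :: v⟩ = movedLeft u q' (y :: v) :=
  Machine.next_of_left (T := sqMachine) (v := x :: v) h

theorem reach_toMark {d : Config SqLetter SqState} {p : List SqLetter} (s : ℕ) :
    ∀ v, Reach (movedLeft p findLetter (e :: replicate s a ++ v)) d →
      Reach (movedLeft (p ++ e :: replicate s a) toMark v) d := by
  induction s with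
  | zero =>
    intro v h
    rw [replicate_zero, movedLeft_concat]
    refine Reach.head (by simp) (by simp [Config.contents]) ?_
    rw [next_of_left (q' := findLetter) (y := e) rfl]
    simpa using h
  | succ s ih =>
    intro v h
    rw [replicate_succ', ← cons_append, ← append_assoc, movedLeft_concat]
    refine Reach.head (by simp) (by simp [Config.contents]) ?_
    rw [next_of_left (q' := toMark) (y := a) rfl]
    refine ih _ ?_
    rw [replicate_succ'] at h
    simpa using h

theorem reach_findLetter {d : Config SqLetter SqState} {p : List SqLetter} (l : ℕ) :
    ∀ v, e ∈ v → Reach (movedLeft p findLetter (replicate l b ++ v)) d →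
      Reach (movedLeft (p ++ replicate l b) findLetter v) d := by
  induction l with
  | zero =>
    intro v _ h
    simpa using h
  | succ l ih =>
    intro v hv h
    rw [replicate_succ', ← append_assoc, movedLeft_concat]
    refine Reach.head (by simp) (by simp [Config.contents, hv]) ?_
    rw [next_of_left (q' := findLetter) (y := b) rfl]
    refine ih _ (by simp [hv]) ?_
    rw [replicate_succ'] at h
    simpa using h

theorem reach_unmark {v : List SqLetter} (l : ℕ) : ∀ u,
    Reach ⟨u, unmark, replicate l b ++ e :: v⟩ ⟨u ++ replicate l a, square, a :: v⟩ := by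
  induction l with
  | zero =>
    intro u
    refine Reach.head (by simp) (by simp [Config.contents]) ?_
    rw [Machine.next_of_stay (T := sqMachine) (q' := square) (b := a) rfl]
    simpa using Reach.refl _
  | succ l ih =>
    intro u
    refine Reach.head (by simp) (by simp [Config.contents]) ?_
    rw [Machine.next_of_right (T := sqMachine) (q' := unmark) (b := a) rfl]
    have := ih (u ++ [a])
    simpa [replicate_succ] using this

/-- With `k` letters to the left of the marks, `l + 1` marks and `s` letters on the right, the head
at the right end. -/
def marked (k l s : ℕ) : Config SqLetter SqState :=
  ⟨replicate k a ++ replicate l b ++ e :: replicate s a, toRight, []⟩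

/-- One round for one mark: two letters are appended at the right end, then the head returns over
the letters and marks to the cell left of the marks. -/
theorem reach_of_marked {d : Config SqLetter SqState} {k l s : ℕ}
    (h : Reach (movedLeft (replicate k a) findLetter
      (replicate l b ++ e :: replicate (s + 2) a)) d) : Reach (marked k l s) d := by
  refine Reach.head (by simp [marked]) (by simp [marked, Config.contents]) ?_
  rw [marked, Machine.next_of_right (T := sqMachine) (q' := append) (b := a) rfl]
  refine Reach.head (by simp) (by simp [Config.contents]) ?_
  rw [Machine.next_of_left (T := sqMachine) (q' := toMark) (b := a) rfl]
  have := reach_toMark (p := replicate k a ++ replicate l b) (d := d) (s + 1) [a]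
    (reach_findLetter l _ (by simp) (by
      have e : e :: replicate (s + 1) a ++ [a] = e :: replicate (s + 2) a := by
        rw [replicate_succ' (n := s + 1)]
        simp
      rwa [e]))
  have e : replicate k a ++ replicate l b ++ e :: replicate (s + 1) a =
      replicate k a ++ replicate l b ++ e :: replicate s a ++ [a] := by
    simp [replicate_succ']
  rw [e] at this
  exact this

theorem reach_of_marked_succ {d : Config SqLetter SqState} {k l s : ℕ}
    (h : Reach (marked k (l + 1) (s + 2)) d) : Reach (marked (k + 1) l s) d := by
  refine reach_of_marked ?_
  rw [replicate_succ', movedLeft_concat]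
  refine Reach.head (by simp) (by simp [Config.contents]) ?_
  rw [Machine.next_of_right (T := sqMachine) (q' := toRight) (b := b) rfl]
  refine reach_toRight _ _ (by simp) (by simp) ?_
  simpa [marked, replicate_succ] using h

/-- No letter is left to mark, so the head reads the blank beyond the left end. It becomes the extra
`a`, and unmarking stops at `e`, one place to the right of the old root. -/
theorem reach_of_marked_zero {l s : ℕ} : Reach (marked 0 l s)
    ⟨replicate (l + 1) a, square, a :: replicate (s + 2) a⟩ := by
  refine reach_of_marked ?_
  refine Reach.head (by simp [movedLeft]) (by simp [movedLeft, Config.contents]) ?_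
  rw [replicate_zero, movedLeft, Machine.next_of_right (T := sqMachine) (q' := unmark) (b := a) rfl]
  simpa [replicate_succ] using reach_unmark (v := replicate (s + 2) a) l [a]

/-- Each of the `k` letters still to be marked will contribute two letters on the right, and the
latest mark contributes the final two. -/
theorem reach_marked (k : ℕ) : ∀ l s, Reach (marked k l s)
    ⟨replicate (k + l + 1) a, square, a :: replicate (s + 2 * k + 2) a⟩ := by
  induction k with
  | zero =>
    intro l s
    simpa using reach_of_marked_zero (l := l) (s := s)
  | succ k ih =>
    intro l s
    refine reach_of_marked_succ ?_
    convert ih (l + 1) (s + 2) using 4 <;> ring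

/-- The configuration with `a ^ ((m + 1) ^ 2)` on the tape. -/
def squareConfig (m : ℕ) : Config SqLetter SqState :=
  ⟨replicate m a, square, a :: replicate (m ^ 2 + m) a⟩

theorem squareConfig_contents (m : ℕ) :
    (squareConfig m).contents = replicate ((m + 1) ^ 2) a := by
  simp only [squareConfig, Config.contents, ← replicate_succ, ← replicate_add]
  congr 1
  ring

theorem reach_squareConfig (m : ℕ) :
    Reach (sqMachine.next (squareConfig m)) (squareConfig (m + 1)) := by
  rw [squareConfig, Machine.next_of_right (T := sqMachine) (q' := toRight) (b := e) rfl]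
  refine reach_toRight _ _ (by simp) (by simp) ?_
  have h := reach_marked m 0 (m ^ 2 + m)
  have e : m ^ 2 + m + 2 * m + 2 = (m + 1) ^ 2 + (m + 1) := by ring
  rw [e] at h
  simpa [marked, squareConfig] using h

theorem generatesSquares_sqMachine : sqMachine.GeneratesSquares := by
  let good : ℕ → Prop := fun n => (sqMachine.run n).q = square ↔
    ∃ j, 1 ≤ j ∧ (sqMachine.run n).contents = replicate (j ^ 2) a
  choose k hk hb using reach_squareConfig
  -- The first square appears after one step; each later one takes the step out of `squareConfig m`
  -- and then `k m` further steps.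
  let t : ℕ → ℕ := fun m => Nat.rec 1 (fun m n => k m + 1 + n) m
  have ht : ∀ m, t (m + 1) = k m + 1 + t m := fun m => rfl
  have hmono : StrictMono t := strictMono_nat_of_lt_succ fun m => by rw [ht]; omega
  have hrun : ∀ m, sqMachine.run (t m) = squareConfig m := by
    intro m
    induction m with
    | zero => rfl
    | succ m ih =>
      rw [ht, Machine.run, Function.iterate_add_apply, Function.iterate_succ_apply]
      rw [Machine.run] at ih
      rw [ih, hk]
  have hgood : ∀ m n, n < t m → good n := by
    intro m
    induction m with
    | zero =>
      intro n hn
      obtain rfl : n = 0 := by change n < 1 at hn; omega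
      refine ⟨fun h => ?_, fun ⟨j, hj, h⟩ => ?_⟩
      · cases h
      · have := congrArg length h
        rw [length_replicate] at this
        have h' : 0 = j ^ 2 := this
        nlinarith
    | succ m ih =>
      intro n hn
      rcases lt_trichotomy n (t m) with h | rfl | h
      · exact ih n h
      · simp only [good]
        rw [hrun, squareConfig_contents]
        exact ⟨fun _ => ⟨m + 1, by omega, rfl⟩, fun _ => rfl⟩
      -- Strictly between two squares both sides of the equivalence fail: the state is not `square`,
      -- and the letter `e` on the tape excludes a power of `a`.
      · obtain ⟨i, rfl⟩ : ∃ i, n = i + 1 + t m := ⟨n - t m - 1, by omega⟩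
        have hi := hb m i (by rw [ht] at hn; omega)
        have e : sqMachine.run (i + 1 + t m) =
            sqMachine.next^[i] (sqMachine.next (squareConfig m)) := by
          rw [Machine.run, Function.iterate_add_apply, Function.iterate_succ_apply, ← hrun m]
          rfl
        simp only [good]
        rw [e]
        refine ⟨fun h => absurd h hi.1, fun ⟨j, _, h⟩ => ?_⟩
        have := hi.2
        rw [h] at this
        exact absurd (eq_of_mem_replicate this) (by simp)
  refine ⟨⟨t, hmono, fun j => ?_⟩,
    fun n => hgood (n + 1) n (n.lt_succ_self.trans_le hmono.le_apply)⟩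
  rw [hrun]
  exact ⟨rfl, squareConfig_contents j⟩

end SquareMachine

end FAPres

theorem mainTheorem5 :
    -- a machine as required by the construction exists
    (∃ (B Q : Type) (_ : Finite B) (_ : Finite Q) (T : FAPres.Machine B Q), T.GeneratesSquares) ∧
    -- the algebras constructed from any such machine and any order on the letters
    (∀ (B Q : Type) [Finite B] [Finite Q] (T : FAPres.Machine B Q) (r : B ⊕ Q → B ⊕ Q → Prop)
        [IsStrictTotalOrder (B ⊕ Q) r], T.GeneratesSquares →
      FAPres.OnlyUnaryOperations FAPres.unLang ∧
      FAPres.FAPresentable FAPres.unLang (FAPres.AlgX' T r) ∧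
      FirstOrder.Language.Structure.FG FAPres.unLang (FAPres.AlgX' T r) ∧
      (FAPres.subY T r : Set (FAPres.AlgX T r)) = FAPres.setY T ∧
      (FAPres.subY' T r : Set (FAPres.AlgX' T r)) = FAPres.setY T ∧
      ¬ FAPres.FAPresentable FAPres.unLang (FAPres.subY' T r)) ∧
    -- non-closure in the class of algebras with finitely many operations, all of them unary
    ¬ (∀ (L : FirstOrder.Language.{0, 0}) (M : Type) [L.Structure M],
        FAPres.OnlyUnaryOperations L → Finite (L.Functions 1) →
        FirstOrder.Language.Structure.FG L M → FAPres.FAPresentable L M →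
        ∀ S : L.Substructure M, S.FG → FAPres.FAPresentable L S) := by
  have hun : FAPres.OnlyUnaryOperations FAPres.unLang :=
    ⟨fun _ => inferInstanceAs (IsEmpty Empty), fun n hn => ⟨fun f => by cases f <;> exact hn rfl⟩⟩
  refine ⟨⟨_, _, inferInstance, inferInstance, _, FAPres.generatesSquares_sqMachine⟩,
    fun B Q _ _ T r _ hT => ⟨hun, FAPres.faPresentable_algX' T r, FAPres.fg_algX' T r,
      FAPres.coe_subY r hT, FAPres.coe_subY' r hT, FAPres.not_faPresentable_subY' r hT⟩,
    fun h => ?_⟩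
  have hfin : Finite (FAPres.unLang.Functions 1) := by
    refine Finite.of_surjective (α := Fin 7) ![FAPres.UnFn.alpha, .beta, .gamma, .delta, .zeta,
      .lambda, .mu] fun f => ?_
    cases f
    exacts [⟨0, rfl⟩, ⟨1, rfl⟩, ⟨2, rfl⟩, ⟨3, rfl⟩, ⟨4, rfl⟩, ⟨5, rfl⟩, ⟨6, rfl⟩]
  -- Any strict total order on the letters will do for the counterexample.
  exact FAPres.not_faPresentable_subY' WellOrderingRel FAPres.generatesSquares_sqMachine
    (h _ _ hun hfin (FAPres.fg_algX' FAPres.sqMachine WellOrderingRel)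
      (FAPres.faPresentable_algX' _ _) _
      (FirstOrder.Language.Substructure.fg_closure_singleton _))
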